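/- **Definitions.** Let $G$ be a topological group (not necessarily Hausdorff). $G$ is *precompact* if every non-empty open subset $V\subseteq G$ has finitely many left translates covering $G$, and *$\omega$-bounded* if every non-empty open $V\subseteq G$ has countably many left translates covering $G$ (every separable group is $\omega$-bounded). A *Urysohn space* is a complete separable metric space $U$ into which every separable metric space embeds isometrically and in which every isometry between finite subspaces extends to an isometry of $U$ onto itself. For a metric space $X$ with a distinguished point $*$, let $L(X,*)$ be the real vector space with Hamel basis $X\setminus\{*\}$ and with $*$ as zero, equipped with the largest prenorm $p$ such that $p(x-y)\le d(x,y)$ for all $x,y\in X$; the *free Banach space* $B(X,*)$ is the completion of $L(X,*)$. The *Holmes space* is $\langle\mathbb U\rangle=B(\mathbb U,*)$ for a Urysohn space $\mathbb U$. An action of $G$ by affine isometries on a Banach space $E$ is *continuous* if the map $G\times E\to E$ is continuous, and *strongly moving* if there is $\varepsilon>0$ such that for every finite $F\subseteq E$ there is $g\in G$ with $\|x-gy\|\ge\varepsilon$ for all $x,y\in F$. **Theorem.** Let $G$ be a topological group that is separable or, more generally, $\omega$-bounded. A Urysohn space exists, and for every Urysohn space $\mathbb U$ and every distinguished point $*\in\mathbb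 U$, with $\langle\mathbb U\rangle=B(\mathbb U,*)$, the following conditions are equivalent: 1. $G$ is not precompact; 2. $G$ admits a continuous action by affine isometries on $\langle\mathbb U\rangle$ without a fixed point; 3. $G$ admits a strongly moving continuous action by affine isometries on $\langle\mathbb U\rangle$. Consequently, $G$ is precompact if and only if every continuous action of $G$ by affine isometries on $\langle\mathbb U\rangle$ has a fixed point. -/

import Mathlib

open Topology Pointwise

universe u v

noncomputable section

/-! ### Precompact and ω-bounded topological groups -/

/-- Finitely many left translates of every non-empty open subset cover `G`. -/
def IsPrecompactGroup (G : Type u) [Group G] [TopologicalSpace G] : Prop :=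
  ∀ V : Set G, IsOpen V → V.Nonempty → ∃ F : Set G, F.Finite ∧ F * V = Set.univ

/-- Countably many left translates of every non-empty open subset cover `G`. -/
def IsOmegaBoundedGroup (G : Type u) [Group G] [TopologicalSpace G] : Prop :=
  ∀ V : Set G, IsOpen V → V.Nonempty → ∃ S : Set G, S.Countable ∧ S * V = Set.univ

/-! ### The Urysohn space -/

/-- `U` is a Urysohn space: a complete separable metric space, universal for separable metric
spaces, in which every isometry between finite subspaces extends to an isometry of `U` onto itself.
(A separable metric space has at most continuum many points, so it has an isometric copy whose
points form a type in the lowest universe.) -/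
structure IsUrysohnSpace (U : Type u) [MetricSpace U] : Prop where
  complete : CompleteSpace U
  separable : TopologicalSpace.SeparableSpace U
  universal : ∀ (X : Type) [MetricSpace X] [TopologicalSpace.SeparableSpace X],
    ∃ i : X → U, Isometry i
  ultrahomogeneous : ∀ (A B : Set U), A.Finite → B.Finite → ∀ f : A ≃ᵢ B,
    ∃ F : U ≃ᵢ U, ∀ a : A, F a = f a

/-! ### The Lipschitz-free Banach space of a pointed metric space -/

/-- The real vector space `L(X, o)` with Hamel basis `X \ {o}`. -/
def FreeNormedSpace (X : Type u) (o : X) : Type u := {x : X // x ≠ o} →₀ ℝ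

namespace FreeNormedSpace

instance instAddCommGroup (X : Type u) (o : X) : AddCommGroup (FreeNormedSpace X o) :=
  inferInstanceAs (AddCommGroup ({x : X // x ≠ o} →₀ ℝ))

instance instModule (X : Type u) (o : X) : Module ℝ (FreeNormedSpace X o) :=
  inferInstanceAs (Module ℝ ({x : X // x ≠ o} →₀ ℝ))

/-- The coordinates of a vector of `L(X, o)` with respect to the Hamel basis `X \ {o}`. -/
def coords (X : Type u) (o : X) : FreeNormedSpace X o ≃ₗ[ℝ] ({x : X // x ≠ o} →₀ ℝ) :=
  LinearEquiv.refl ℝ ({x : X // x ≠ o} →₀ ℝ)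

open Classical in
/-- The canonical map `X → L(X, o)`; it sends `o` to zero and every other point to itself, seen as
a basis vector. -/
def point {X : Type u} (o x : X) : FreeNormedSpace X o :=
  if h : x = o then 0 else (coords X o).symm (Finsupp.single ⟨x, h⟩ 1)

/-- The prenorms on `L(X, o)` whose restriction to `X` is bounded by the distance. -/
def boundedPrenorms (X : Type u) [MetricSpace X] (o : X) : Set (Seminorm ℝ (FreeNormedSpace X o)) :=
  {p | ∀ x y : X, p (point o x - point o y) ≤ dist x y}

/-- The largest prenorm on `L(X, o)` whose restriction to `X` is bounded by the distance. -/
def maxPrenorm (X : Type u) [MetricSpace X] (o : X) : Seminorm ℝ (FreeNormedSpace X o) :=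
  sSup (boundedPrenorms X o)

theorem bddAbove_boundedPrenorms (X : Type u) [MetricSpace X] (o : X) :
    BddAbove (boundedPrenorms X o) := by
  rw [Seminorm.bddAbove_iff, bddAbove_pi]
  intro v
  refine ⟨(coords X o v).sum fun x c => |c| * dist (x : X) o, ?_⟩
  rintro _ ⟨_, ⟨p, hp, rfl⟩, rfl⟩
  have hv : v = (coords X o v).sum fun x c => c • point o (x : X) := by
    apply (coords X o).injective
    conv_lhs => rw [← Finsupp.sum_single (coords X o v)]
    rw [Finsupp.sum, Finsupp.sum, map_sum]
    refine Finset.sum_congr rfl fun x _ => ?_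
    rw [map_smul, point, dif_neg x.2, LinearEquiv.apply_symm_apply, Finsupp.smul_single_one]
  have hq : p v ≤ (coords X o v).sum fun x c => p (c • point o (x : X)) := by
    conv_lhs => rw [hv]
    exact Finset.le_sum_of_subadditive p (map_zero p).le (map_add_le_add p) _ _
  refine hq.trans (Finset.sum_le_sum fun x _ => ?_)
  have h := hp x o
  have h0 : point o o = (0 : FreeNormedSpace X o) := dif_pos rfl
  rw [h0, sub_zero] at h
  simp only [map_smul_eq_mul, Real.norm_eq_abs]
  exact mul_le_mul_of_nonneg_left h (abs_nonneg _)

/-- The prenorm above is indeed the largest element of the set of prenorms considered. -/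
theorem isGreatest_maxPrenorm (X : Type u) [MetricSpace X] (o : X) :
    IsGreatest (boundedPrenorms X o) (maxPrenorm X o) := by
  refine ⟨fun x y => ?_, fun p hp => le_csSup (bddAbove_boundedPrenorms X o) hp⟩
  have hne : Nonempty (boundedPrenorms X o) := ⟨⟨0, fun x y => dist_nonneg⟩⟩
  rw [maxPrenorm, Seminorm.sSup_apply (bddAbove_boundedPrenorms X o)]
  exact ciSup_le fun p => p.2 x y

instance instSeminormedAddCommGroup (X : Type u) [MetricSpace X] (o : X) :
    SeminormedAddCommGroup (FreeNormedSpace X o) :=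
  (maxPrenorm X o).toAddGroupSeminorm.toSeminormedAddCommGroup

instance instNormedSpace (X : Type u) [MetricSpace X] (o : X) :
    NormedSpace ℝ (FreeNormedSpace X o) where
  norm_smul_le c v := (map_smul_eq_mul (maxPrenorm X o) c v).le

end FreeNormedSpace

/-- The free Banach space `B(X, o)`: the completion of `L(X, o)` in the largest prenorm. -/
abbrev FreeBanachSpace (X : Type u) [MetricSpace X] (o : X) : Type u :=
  UniformSpace.Completion (FreeNormedSpace X o)

/-! ### Actions by affine isometries -/

section Actions

variable {G : Type u} [Group G] {E : Type v} [NormedAddCommGroup E] [NormedSpace ℝ E]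

/-- The action of `G` on `E` by affine isometries given by `ρ` is (jointly) continuous. -/
def IsContinuousAction [TopologicalSpace G] (ρ : G →* (E ≃ᵃⁱ[ℝ] E)) : Prop :=
  Continuous fun q : G × E => ρ q.1 q.2

def HasFixedPoint (ρ : G →* (E ≃ᵃⁱ[ℝ] E)) : Prop :=
  ∃ ξ : E, ∀ g : G, ρ g ξ = ξ

/-- For some `ε > 0`, every finite set `F` has a translate `gF` at distance at least `ε` from it. -/
def IsStronglyMoving (ρ : G →* (E ≃ᵃⁱ[ℝ] E)) : Prop :=
  ∃ ε : ℝ, 0 < ε ∧ ∀ F : Set E, F.Finite →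
    ∃ g : G, ∀ x ∈ F, ∀ y ∈ F, ε ≤ dist x (ρ g y)

end Actions

end

universe w

/-! ### Katětov functions -/

/-! If `G` is precompact, every orbit of a continuous action is totally bounded, so the closed
convex hull of an orbit is compact and invariant. A minimal invariant compact convex subset of it
must be a point, since compact convex sets have normal structure
(`exists_fixed_point_of_isCompact_of_convex`). A strongly moving action has no fixed point `ξ`: take
the finite set `{ξ}`.

It remains to build a strongly moving action when `G` is not precompact. A Neumann-type covering
lemma gives a neighbourhood `V` of `1` with `F * V * F⁻¹ ≠ univ` for all finite `F`. For a
continuous left-invariant pseudometric with a small ball inside `V`, left translations then move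
every finite subset of `G` uniformly away from itself, and ω-boundedness makes this pseudometric
separable (`IsOmegaBoundedGroup.exists_movesFiniteSets`).

The action is carried to `𝕌` by Katětov's construction: iterate the space of lower envelopes, take
the union and complete. Each step is functorial, so `G` acts, and `MovesFiniteSets.katetovSpace`
shows that finite sets are still moved. The result has one-point extensions, so a back-and-forth
argument identifies it with any Urysohn space; the same argument proves existence and uniqueness of
`𝕌`.

Finally, an isometric action on `𝕌` extends to affine isometries of the free Banach space. Finite
sets there are separated by the functional that extends a truncated distance function
(`exists_le_dist_affineMap`). -/

/-- A Katětov function: the distances to the points of `X` from a point of some metric space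
containing `X`. -/
def IsKatetov {X : Type w} [PseudoMetricSpace X] (f : X → ℝ) : Prop :=
  ∀ x y, f x ≤ f y + dist x y ∧ dist x y ≤ f x + f y

/-- The lower envelope of the functions `z ↦ dist z x + r`, where `(x, r)` runs over the values of
`p`. -/
noncomputable def katetovInf {X : Type w} [PseudoMetricSpace X] {ι : Type*} (p : ι → X × ℝ)
    (z : X) : ℝ :=
  ⨅ i, (dist z (p i).1 + (p i).2)

section katetovInf

variable {X : Type w} [PseudoMetricSpace X] {ι : Type*}

theorem dist_inv_smul_left {G : Type u} [Group G] [MulAction G X] [IsIsometricSMul G X]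
    (g : G) (x y : X) : dist (g⁻¹ • x) y = dist x (g • y) := by
  rw [← dist_smul g, smul_inv_smul]

theorem katetovInf_smul {G : Type u} [Group G] [MulAction G X] [IsIsometricSMul G X]
    (p : ι → X × ℝ) (g : G) (z : X) :
    katetovInf (fun i => (g • (p i).1, (p i).2)) z = katetovInf p (g⁻¹ • z) := by
  unfold katetovInf
  simp only [dist_inv_smul_left]

variable [Finite ι]

theorem katetovInf_le (p : ι → X × ℝ) (i : ι) (z : X) :
    katetovInf p z ≤ dist z (p i).1 + (p i).2 :=
  ciInf_le (Set.finite_range _).bddBelow i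

theorem exists_katetovInf_eq [Nonempty ι] (p : ι → X × ℝ) (z : X) :
    ∃ i, dist z (p i).1 + (p i).2 = katetovInf p z :=
  exists_eq_ciInf_of_finite

theorem katetovInf_le_add_dist [Nonempty ι] (p : ι → X × ℝ) (z w : X) :
    katetovInf p z ≤ katetovInf p w + dist z w := by
  obtain ⟨i, hi⟩ := exists_katetovInf_eq p w
  have h1 := katetovInf_le p i z
  have h2 := dist_triangle z w (p i).1
  linarith

theorem katetovInf_apply_self [Nonempty ι] {p : ι → X × ℝ}
    (hp : ∀ i j, (p i).2 ≤ (p j).2 + dist (p i).1 (p j).1) (i : ι) :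
    katetovInf p (p i).1 = (p i).2 := by
  refine le_antisymm ?_ ?_
  · simpa using katetovInf_le p i (p i).1
  · obtain ⟨j, hj⟩ := exists_katetovInf_eq p (p i).1
    rw [← hj, add_comm]
    exact hp i j

theorem isKatetov_katetovInf [Nonempty ι] {p : ι → X × ℝ}
    (hp : ∀ i j, dist (p i).1 (p j).1 ≤ (p i).2 + (p j).2) : IsKatetov (katetovInf p) := by
  refine fun x y => ⟨katetovInf_le_add_dist p x y, ?_⟩
  obtain ⟨i, hi⟩ := exists_katetovInf_eq p x
  obtain ⟨j, hj⟩ := exists_katetovInf_eq p y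
  have h1 := dist_triangle4 x (p i).1 (p j).1 y
  have h2 := hp i j
  rw [dist_comm (p j).1 y] at h1
  linarith

/-- Lower envelopes are unbounded in general; staying at bounded distance from `z ↦ dist z x` is
what makes the sup distance between two of them finite. -/
theorem exists_abs_katetovInf_sub_dist_le [Nonempty ι] (p : ι → X × ℝ) (x : X) :
    ∃ C, ∀ z, |katetovInf p z - dist z x| ≤ C := by
  obtain ⟨C, hC⟩ := (Set.finite_range fun i => dist x (p i).1 + |(p i).2|).bddAbove
  have hC' : ∀ i, dist x (p i).1 + |(p i).2| ≤ C := fun i => hC ⟨i, rfl⟩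
  refine ⟨C, fun z => ?_⟩
  obtain ⟨i, hi⟩ := exists_katetovInf_eq p z
  rw [← hi, abs_le]
  have h1 := hC' i
  have h2 := neg_abs_le (p i).2
  have h3 := le_abs_self (p i).2
  have h4 := dist_triangle z (p i).1 x
  have h5 := dist_triangle z x (p i).1
  rw [dist_comm (p i).1 x] at h4
  constructor <;> linarith

end katetovInf

/-! ### The space of lower envelopes -/

/-- The space of all lower envelopes of finitely many functions `z ↦ dist z x + r`; the points of
`X` sit in it as the functions `z ↦ dist z x`. -/
def KatetovSpace (X : Type w) [PseudoMetricSpace X] : Type w :=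
  {φ : X → ℝ // ∃ (n : ℕ) (p : Fin (n + 1) → X × ℝ), katetovInf p = φ}

namespace KatetovSpace

variable {X : Type w} [PseudoMetricSpace X]

/-- No Katětov condition is imposed on `p`. Hence `mk` is defined on a full product space, and
separability and continuity of orbit maps follow from its being Lipschitz. -/
noncomputable def mk {n : ℕ} (p : Fin (n + 1) → X × ℝ) : KatetovSpace X := ⟨katetovInf p, n, p, rfl⟩

theorem exists_mk (φ : KatetovSpace X) : ∃ (n : ℕ) (p : Fin (n + 1) → X × ℝ), mk p = φ := by
  obtain ⟨_, n, p, rfl⟩ := φ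
  exact ⟨n, p, rfl⟩

noncomputable def point (x : X) : KatetovSpace X := mk (n := 0) fun _ => (x, 0)

theorem point_apply (x z : X) : (point x).1 z = dist z x := by
  simp [point, mk, katetovInf]

theorem le_add_dist (φ : KatetovSpace X) (z w : X) : φ.1 z ≤ φ.1 w + dist z w := by
  obtain ⟨n, p, rfl⟩ := φ.exists_mk
  exact katetovInf_le_add_dist p z w

theorem exists_bound (φ : KatetovSpace X) (x : X) : ∃ C, ∀ z, |φ.1 z - dist z x| ≤ C := by
  obtain ⟨n, p, rfl⟩ := φ.exists_mk
  exact exists_abs_katetovInf_sub_dist_le p x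

theorem continuous_coe (φ : KatetovSpace X) : Continuous φ.1 := by
  refine LipschitzWith.continuous (K := 1) (LipschitzWith.of_le_add fun z w => φ.le_add_dist z w)

section Action

variable {G : Type u} [Group G] [MulAction G X] [IsIsometricSMul G X]

instance : MulAction G (KatetovSpace X) where
  smul g φ := ⟨fun z => φ.1 (g⁻¹ • z), by
    obtain ⟨n, p, rfl⟩ := φ.exists_mk
    exact ⟨n, fun i => (g • (p i).1, (p i).2), funext (katetovInf_smul p g)⟩⟩
  one_smul φ := Subtype.ext <| funext fun z => by
    change φ.1 ((1 : G)⁻¹ • z) = φ.1 z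
    rw [inv_one, one_smul]
  mul_smul g h φ := Subtype.ext <| funext fun z => by
    change φ.1 ((g * h)⁻¹ • z) = φ.1 (h⁻¹ • g⁻¹ • z)
    rw [mul_inv_rev, mul_smul]

theorem smul_apply (g : G) (φ : KatetovSpace X) (z : X) : (g • φ).1 z = φ.1 (g⁻¹ • z) := rfl

theorem smul_mk {n : ℕ} (g : G) (p : Fin (n + 1) → X × ℝ) :
    g • mk p = mk fun i => (g • (p i).1, (p i).2) :=
  Subtype.ext (funext fun z => (katetovInf_smul p g z).symm)

theorem smul_point (g : G) (x : X) : g • point x = point (g • x) := smul_mk g _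

end Action

variable [Nonempty X]

/-- The difference of a lower envelope and the distance to a fixed point. -/
noncomputable def toBounded (φ : KatetovSpace X) : BoundedContinuousFunction X ℝ :=
  BoundedContinuousFunction.ofNormedAddCommGroup
    (fun z => φ.1 z - dist z (Classical.arbitrary X))
    (φ.continuous_coe.sub (continuous_id.dist continuous_const))
    (φ.exists_bound (Classical.arbitrary X)).choose
    (φ.exists_bound (Classical.arbitrary X)).choose_spec

theorem toBounded_apply (φ : KatetovSpace X) (z : X) :
    φ.toBounded z = φ.1 z - dist z (Classical.arbitrary X) := rfl

theorem toBounded_injective : Function.Injective (toBounded (X := X)) := by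
  intro φ ψ h
  refine Subtype.ext (funext fun z => ?_)
  have := DFunLike.congr_fun h z
  simpa [toBounded_apply] using this

/-- This is the sup distance: the subtracted reference function cancels in differences, as
`dist_le_iff` records. -/
noncomputable instance : MetricSpace (KatetovSpace X) :=
  MetricSpace.induced toBounded toBounded_injective inferInstance

theorem dist_le_iff {φ ψ : KatetovSpace X} {C : ℝ} :
    dist φ ψ ≤ C ↔ ∀ z, |φ.1 z - ψ.1 z| ≤ C := by
  change dist φ.toBounded ψ.toBounded ≤ C ↔ _
  rw [BoundedContinuousFunction.dist_le_iff_of_nonempty]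
  refine forall_congr' fun z => ?_
  rw [Real.dist_eq, toBounded_apply, toBounded_apply, sub_sub_sub_cancel_right]

theorem abs_sub_le_dist (φ ψ : KatetovSpace X) (z : X) : |φ.1 z - ψ.1 z| ≤ dist φ ψ :=
  dist_le_iff.1 le_rfl z

instance : Nonempty (KatetovSpace X) := ⟨point (Classical.arbitrary X)⟩

theorem isometry_point : Isometry (point (X := X)) := by
  refine Isometry.of_dist_eq fun x y => le_antisymm (dist_le_iff.2 fun z => ?_) ?_
  · rw [point_apply, point_apply]
    exact dist_dist_dist_le_right z x y
  · have := abs_sub_le_dist (point x) (point y) x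
    simpa [point_apply, abs_of_nonneg] using this

/-- Every Katětov function is realized on every finite set by a point of `KatetovSpace X`. -/
theorem exists_dist_point_eq {f : X → ℝ} (hf : IsKatetov f) {s : Set X} (hs : s.Finite) :
    ∃ φ : KatetovSpace X, ∀ x ∈ s, dist φ (point x) = f x := by
  rcases s.eq_empty_or_nonempty with rfl | hne
  · exact ⟨Classical.arbitrary _, by simp⟩
  have := hs.to_subtype
  have := hne.to_subtype
  obtain ⟨n, ⟨e⟩⟩ := Finite.exists_equiv_fin s
  obtain ⟨n, rfl⟩ : ∃ m, n = m + 1 := by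
    refine Nat.exists_eq_succ_of_ne_zero ?_
    rintro rfl
    exact (e ⟨_, hne.choose_spec⟩).elim0
  let p : Fin (n + 1) → X × ℝ := fun i => ((e.symm i : X), f (e.symm i))
  have hp : ∀ i, (mk p).1 (p i).1 = (p i).2 :=
    katetovInf_apply_self (p := p) fun i j => (hf _ _).1
  -- The envelope is the largest 1-Lipschitz function agreeing with `f` on `s`, so it dominates `f`;
  -- this transfers the lower bound `dist z x - f x ≤ f z` to it.
  have hfp : ∀ z, f z ≤ (mk p).1 z := by
    intro z
    obtain ⟨i, hi⟩ := exists_katetovInf_eq p z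
    change _ ≤ katetovInf p z
    rw [← hi, add_comm]
    exact (hf _ _).1
  refine ⟨mk p, fun x hx => ?_⟩
  have hx1 : (p (e ⟨x, hx⟩)).1 = x := by simp [p]
  have hx2 : (p (e ⟨x, hx⟩)).2 = f x := by simp [p]
  refine le_antisymm (dist_le_iff.2 fun z => ?_) ?_
  · have h1 := katetovInf_le p (e ⟨x, hx⟩) z
    rw [hx1, hx2] at h1
    have h2 := (hf z x).2
    have h3 := hfp z
    change katetovInf p z ≤ _ at h1
    rw [point_apply, abs_le]
    change f z ≤ katetovInf p z at h3
    change -f x ≤ katetovInf p z - _ ∧ katetovInf p z - _ ≤ _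
    constructor <;> linarith
  · have h1 := abs_sub_le_dist (mk p) (point x) x
    have h2 := hp (e ⟨x, hx⟩)
    rw [hx1, hx2] at h2
    rw [h2, point_apply, dist_self, sub_zero] at h1
    exact (le_abs_self _).trans h1

/-- One `dist p q` pays for moving the centre, the other for changing the additive constant. -/
theorem dist_mk_le {n : ℕ} (p q : Fin (n + 1) → X × ℝ) : dist (mk p) (mk q) ≤ 2 * dist p q := by
  have key : ∀ p q : Fin (n + 1) → X × ℝ, ∀ z, katetovInf p z ≤ katetovInf q z + 2 * dist p q := by
    intro p q z
    obtain ⟨i, hi⟩ := exists_katetovInf_eq q z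
    have h1 := katetovInf_le p i z
    have h2 : dist (p i).1 (q i).1 ≤ dist p q := (le_max_left _ _).trans (dist_le_pi_dist p q i)
    have h3 : dist (p i).2 (q i).2 ≤ dist p q := (le_max_right _ _).trans (dist_le_pi_dist p q i)
    have h4 := dist_triangle z (q i).1 (p i).1
    rw [dist_comm (q i).1] at h4
    have h5 := (le_abs_self _).trans ((Real.dist_eq _ _).symm.le.trans h3)
    linarith
  refine dist_le_iff.2 fun z => ?_
  have h1 := key p q z
  have h2 := key q p z
  rw [dist_comm q p] at h2
  rw [abs_le]
  change -_ ≤ katetovInf p z - katetovInf q z ∧ katetovInf p z - katetovInf q z ≤ _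
  constructor <;> linarith

theorem continuous_mk (n : ℕ) : Continuous (mk (X := X) (n := n)) :=
  LipschitzWith.continuous (K := 2) (LipschitzWith.of_dist_le_mul fun p q => dist_mk_le p q)

instance [TopologicalSpace.SeparableSpace X] :
    TopologicalSpace.SeparableSpace (KatetovSpace X) := by
  rw [← TopologicalSpace.isSeparable_univ_iff]
  have : (Set.univ : Set (KatetovSpace X)) = ⋃ n : ℕ, Set.range (mk (X := X) (n := n)) := by
    refine (Set.eq_univ_of_forall fun φ => ?_).symm
    obtain ⟨n, p, rfl⟩ := φ.exists_mk
    exact Set.mem_iUnion.2 ⟨n, p, rfl⟩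
  rw [this]
  exact TopologicalSpace.IsSeparable.iUnion fun n =>
    TopologicalSpace.isSeparable_range (continuous_mk n)

variable {G : Type u} [Group G] [MulAction G X] [IsIsometricSMul G X]

instance : IsIsometricSMul G (KatetovSpace X) := by
  have key : ∀ (g : G) (φ ψ : KatetovSpace X), dist (g • φ) (g • ψ) ≤ dist φ ψ := fun g φ ψ =>
    dist_le_iff.2 fun z => abs_sub_le_dist φ ψ (g⁻¹ • z)
  refine ⟨fun g => Isometry.of_dist_eq fun φ ψ => le_antisymm (key g φ ψ) ?_⟩
  simpa using key g⁻¹ (g • φ) (g • ψ)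

theorem continuous_smul_left [TopologicalSpace G] (hX : ∀ x : X, Continuous fun g : G => g • x)
    (φ : KatetovSpace X) : Continuous fun g : G => g • φ := by
  obtain ⟨n, p, rfl⟩ := φ.exists_mk
  simp only [smul_mk]
  exact (continuous_mk n).comp (continuous_pi fun i => (hX _).prodMk continuous_const)

end KatetovSpace

/-- Every finite set has a translate at distance at least `ε` from it. -/
def MovesFiniteSets (G : Type u) (X : Type w) [SMul G X] [PseudoMetricSpace X] (ε : ℝ) : Prop :=
  ∀ s : Set X, s.Finite → ∃ g : G, ∀ x ∈ s, ∀ y ∈ s, ε ≤ dist x (g • y)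

/-- Choose `g` moving all centres of the envelopes involved. Let `φ` and `ψ` have least constants
`r` and `r'`. If `r ≤ r'`, evaluate at the centre carrying `r`: there `φ` is at most `r`, while `g •
ψ` is at least `ε + r'`. The other case is symmetric, so `ε` is not diminished. -/
theorem MovesFiniteSets.katetovSpace {G : Type u} [Group G] {X : Type w} [PseudoMetricSpace X]
    [Nonempty X] [MulAction G X] [IsIsometricSMul G X] {ε : ℝ} (h : MovesFiniteSets G X ε) :
    MovesFiniteSets G (KatetovSpace X) ε := by
  intro s hs
  choose n p hp using fun φ : KatetovSpace X => φ.exists_mk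
  have hp' : ∀ (φ : KatetovSpace X) (z : X), φ.1 z = katetovInf (p φ) z := fun φ z =>
    congrFun (congrArg Subtype.val (hp φ).symm) z
  obtain ⟨g, hg⟩ := h (⋃ φ ∈ s, Set.range fun i => (p φ i).1)
    (hs.biUnion fun φ _ => Set.finite_range _)
  have hg' : ∀ φ ∈ s, ∀ ψ ∈ s, ∀ i j, ε ≤ dist (p φ i).1 (g • (p ψ j).1) := fun φ hφ ψ hψ i j =>
    hg _ (Set.mem_biUnion hφ ⟨i, rfl⟩) _ (Set.mem_biUnion hψ ⟨j, rfl⟩)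
  refine ⟨g, fun φ hφ ψ hψ => ?_⟩
  obtain ⟨i, hi⟩ := Finite.exists_min fun i => (p φ i).2
  obtain ⟨j, hj⟩ := Finite.exists_min fun j => (p ψ j).2
  rcases le_total (p φ i).2 (p ψ j).2 with hij | hij
  · refine le_trans ?_ (KatetovSpace.abs_sub_le_dist φ (g • ψ) (p φ i).1)
    rw [KatetovSpace.smul_apply, abs_sub_comm]
    refine le_trans ?_ (le_abs_self _)
    have h1 := katetovInf_le (p φ) i (p φ i).1
    obtain ⟨k, hk⟩ := exists_katetovInf_eq (p ψ) (g⁻¹ • (p φ i).1)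
    have h2 := hg' φ hφ ψ hψ i k
    have h3 := hj k
    rw [dist_self] at h1
    rw [dist_inv_smul_left] at hk
    rw [hp', hp']
    linarith
  · refine le_trans ?_ (KatetovSpace.abs_sub_le_dist φ (g • ψ) (g • (p ψ j).1))
    rw [KatetovSpace.smul_apply, inv_smul_smul]
    refine le_trans ?_ (le_abs_self _)
    have h1 := katetovInf_le (p ψ) j (p ψ j).1
    obtain ⟨k, hk⟩ := exists_katetovInf_eq (p φ) (g • (p ψ j).1)
    have h2 := hg' φ hφ ψ hψ k j
    have h3 := hi k
    rw [dist_self] at h1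
    rw [dist_comm] at hk
    rw [hp', hp']
    linarith

/-! ### The Katětov tower -/

/-- A non-empty separable metric space with an isometric action of `G` whose orbit maps are
continuous. -/
structure IsometricGSpace (G : Type u) [Group G] [TopologicalSpace G] where
  carrier : Type w
  [metric : MetricSpace carrier]
  [nonempty : Nonempty carrier]
  [separable : TopologicalSpace.SeparableSpace carrier]
  [action : MulAction G carrier]
  [isometric : IsIsometricSMul G carrier]
  continuous_smul : ∀ x : carrier, Continuous fun g : G => g • x

namespace IsometricGSpace

attribute [instance] metric nonempty separable action isometric

variable {G : Type u} [Group G] [TopologicalSpace G]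

/-- The space of lower envelopes over a separable pseudometric space with an action of `G`. -/
noncomputable def katetov (X : Type w) [PseudoMetricSpace X] [Nonempty X]
    [TopologicalSpace.SeparableSpace X] [MulAction G X] [IsIsometricSMul G X]
    (hX : ∀ x : X, Continuous fun g : G => g • x) : IsometricGSpace.{u, w} G where
  carrier := KatetovSpace X
  continuous_smul := KatetovSpace.continuous_smul_left hX

variable (X : IsometricGSpace.{u, w} G)

/-- The bundled structure lets the recursion carry the metric, the action and their properties from
level to level. -/
noncomputable def tower : ℕ → IsometricGSpace.{u, w} G
  | 0 => X
  | n + 1 => katetov (tower n).carrier (tower n).continuous_smul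

noncomputable def towerMap (n : ℕ) : (X.tower n).carrier → (X.tower (n + 1)).carrier :=
  KatetovSpace.point (X := (X.tower n).carrier)

theorem isometry_towerMap (n : ℕ) : Isometry (X.towerMap n) :=
  KatetovSpace.isometry_point (X := (X.tower n).carrier)

theorem towerMap_smul (n : ℕ) (g : G) (x : (X.tower n).carrier) :
    X.towerMap n (g • x) = g • X.towerMap n x :=
  (KatetovSpace.smul_point (X := (X.tower n).carrier) g x).symm

theorem tower_movesFiniteSets {ε : ℝ} (h : MovesFiniteSets G X.carrier ε) (n : ℕ) :
    MovesFiniteSets G (X.tower n).carrier ε := by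
  induction n with
  | zero => exact h
  | succ n ih => exact ih.katetovSpace

/-- The embedding of a level of the tower into a higher one. -/
noncomputable def towerLift {n m : ℕ} (h : n ≤ m) : (X.tower n).carrier → (X.tower m).carrier :=
  Nat.leRecOn (C := fun n => (X.tower n).carrier) h fun {n} => X.towerMap n

theorem towerLift_self (n : ℕ) (x : (X.tower n).carrier) : X.towerLift le_rfl x = x :=
  Nat.leRecOn_self (C := fun n => (X.tower n).carrier) x

theorem towerLift_succ {n m : ℕ} (h : n ≤ m) (x : (X.tower n).carrier) :
    X.towerLift (h.trans m.le_succ) x = X.towerMap m (X.towerLift h x) :=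
  Nat.leRecOn_succ (C := fun n => (X.tower n).carrier) h x

theorem towerLift_smul {n m : ℕ} (h : n ≤ m) (g : G) (x : (X.tower n).carrier) :
    X.towerLift h (g • x) = g • X.towerLift h x := by
  induction m, h using Nat.le_induction with
  | base => rw [towerLift_self, towerLift_self]
  | succ m h ih => rw [towerLift_succ X h, towerLift_succ X h, ih, towerMap_smul]

/-- The union of the Katětov tower, with each point appearing once for every level it lies in. -/
structure Union : Type w where
  level : ℕ
  point : (X.tower level).carrier

namespace Union

variable {X}

def toSigma (x : X.Union) : Σ n, (X.tower n).carrier := ⟨x.level, x.point⟩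

noncomputable instance : PseudoMetricSpace X.Union :=
  PseudoMetricSpace.induced toSigma (Metric.inductivePremetric X.isometry_towerMap)

/-- The image in the level `m` of a point of a lower level. -/
noncomputable def lift {m : ℕ} (x : X.Union) (h : x.level ≤ m) : (X.tower m).carrier :=
  X.towerLift h x.point

theorem dist_eq_dist_lift {m : ℕ} (x y : X.Union) (hx : x.level ≤ m) (hy : y.level ≤ m) :
    dist x y = dist (x.lift hx) (y.lift hy) :=
  Metric.inductiveLimitDist_eq_dist X.isometry_towerMap x.toSigma y.toSigma m hx hy

theorem lift_mk (n : ℕ) (x : (X.tower n).carrier) : (mk n x).lift le_rfl = x :=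
  X.towerLift_self n x

theorem isometry_mk (n : ℕ) : Isometry (mk (X := X) n) :=
  Isometry.of_dist_eq fun x y => by
    rw [dist_eq_dist_lift (mk n x) (mk n y) le_rfl le_rfl, lift_mk, lift_mk]

theorem lift_mk_succ (n : ℕ) (x : (X.tower n).carrier) :
    (mk n x).lift n.le_succ = X.towerMap n x := by
  change X.towerLift _ x = _
  rw [X.towerLift_succ le_rfl, X.towerLift_self]

theorem dist_mk_lift {m : ℕ} (x : X.Union) (h : x.level ≤ m) : dist x (mk m (x.lift h)) = 0 := by
  rw [dist_eq_dist_lift x (mk m (x.lift h)) h le_rfl, lift_mk, dist_self]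

theorem dist_mk_lift' {m : ℕ} (x y : X.Union) (h : x.level ≤ m) :
    dist (mk m (x.lift h)) y = dist x y := by
  refine le_antisymm ?_ ?_
  · have := dist_triangle (mk m (x.lift h)) x y
    rwa [dist_comm _ x, dist_mk_lift, zero_add] at this
  · have := dist_triangle x (mk m (x.lift h)) y
    rwa [dist_mk_lift, zero_add] at this

instance : Nonempty X.Union := ⟨mk 0 (Classical.arbitrary _)⟩

instance : TopologicalSpace.SeparableSpace X.Union := by
  rw [← TopologicalSpace.isSeparable_univ_iff]
  have : (Set.univ : Set X.Union) = ⋃ n : ℕ, Set.range (mk (X := X) n) :=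
    (Set.eq_univ_of_forall fun x : X.Union =>
      Set.mem_iUnion.2 ⟨x.level, Set.mem_range_self x.point⟩).symm
  rw [this]
  exact TopologicalSpace.IsSeparable.iUnion fun n =>
    TopologicalSpace.isSeparable_range (isometry_mk n).continuous

noncomputable instance : MulAction G X.Union where
  smul g x := mk x.1 (g • x.2)
  one_smul x := congrArg (mk x.1) (one_smul G x.2)
  mul_smul g h x := congrArg (mk x.1) (mul_smul g h x.2)

theorem smul_mk (g : G) (n : ℕ) (x : (X.tower n).carrier) : g • mk n x = mk n (g • x) := rfl

theorem lift_smul {m : ℕ} (g : G) (x : X.Union) (h : x.level ≤ m) :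
    (g • x).lift (m := m) h = g • x.lift h :=
  X.towerLift_smul h g x.point

instance : IsIsometricSMul G X.Union := by
  refine ⟨fun g => Isometry.of_dist_eq fun x y => ?_⟩
  rw [dist_eq_dist_lift (m := max x.1 y.1) (g • x) (g • y) (le_max_left x.1 y.1)
      (le_max_right x.1 y.1), lift_smul, lift_smul, dist_smul,
    dist_eq_dist_lift x y (le_max_left x.1 y.1) (le_max_right x.1 y.1)]

theorem continuous_smul_left (x : X.Union) : Continuous fun g : G => g • x :=
  (isometry_mk x.1).continuous.comp ((X.tower x.1).continuous_smul x.2)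

theorem exists_forall_mem_le {s : Set X.Union} (hs : s.Finite) : ∃ m, ∀ x ∈ s, x.level ≤ m := by
  obtain ⟨m, hm⟩ := (hs.image level).bddAbove
  exact ⟨m, fun x hx => hm ⟨x, hx, rfl⟩⟩

theorem movesFiniteSets {ε : ℝ} (h : MovesFiniteSets G X.carrier ε) :
    MovesFiniteSets G X.Union ε := by
  intro s hs
  obtain ⟨m, hm⟩ := exists_forall_mem_le hs
  obtain ⟨g, hg⟩ := X.tower_movesFiniteSets h m {y | ∃ x, ∃ hx : x ∈ s, x.lift (hm x hx) = y} (by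
    have := hs.to_subtype
    refine (Set.finite_range fun x : s => x.1.lift (hm x.1 x.2)).subset ?_
    rintro _ ⟨x, hx, rfl⟩
    exact ⟨⟨x, hx⟩, rfl⟩)
  refine ⟨g, fun x hx y hy => ?_⟩
  rw [dist_eq_dist_lift (m := m) x (g • y) (hm x hx) (hm y hy), lift_smul]
  exact hg _ ⟨x, hx, rfl⟩ _ ⟨y, hy, rfl⟩

end Union

end IsometricGSpace

/-! ### One-point extensions -/

/-- Every Katětov function is realized on every finite set by a point of the space. -/
def HasOnePointExtensions (X : Type w) [PseudoMetricSpace X] : Prop :=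
  ∀ f : X → ℝ, IsKatetov f → ∀ s : Set X, s.Finite → ∃ z, ∀ x ∈ s, dist z x = f x

theorem IsKatetov.comp_isometry {X : Type v} {Y : Type w} [PseudoMetricSpace X]
    [PseudoMetricSpace Y] {f : Y → ℝ} (hf : IsKatetov f) {i : X → Y} (hi : Isometry i) :
    IsKatetov (f ∘ i) := fun x y => by
  rw [← hi.dist_eq]
  exact hf (i x) (i y)

/-- A finite set lies in a single level `m`, up to distance zero, and level `m + 1` contains a point
realizing `f` on it. -/
theorem IsometricGSpace.Union.hasOnePointExtensions {G : Type u} [Group G] [TopologicalSpace G]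
    (X : IsometricGSpace.{u, w} G) : HasOnePointExtensions X.Union := by
  intro f hf s hs
  obtain ⟨m, hm⟩ := exists_forall_mem_le hs
  obtain ⟨φ, hφ⟩ := KatetovSpace.exists_dist_point_eq
    (hf.comp_isometry (isometry_mk (X := X) m))
    (s := {y | ∃ x, ∃ hx : x ∈ s, x.lift (hm x hx) = y}) (by
      have := hs.to_subtype
      refine (Set.finite_range fun x : s => x.1.lift (hm x.1 x.2)).subset ?_
      rintro _ ⟨x, hx, rfl⟩
      exact ⟨⟨x, hx⟩, rfl⟩)
  refine ⟨mk (m + 1) φ, fun x hx => ?_⟩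
  have h1 := hφ _ ⟨x, hx, rfl⟩
  have h2 : f (mk m (x.lift (hm x hx))) = f x := by
    have h3 := (hf x (mk m (x.lift (hm x hx)))).1
    have h4 := (hf (mk m (x.lift (hm x hx))) x).1
    rw [dist_comm] at h4
    rw [dist_mk_lift] at h3 h4
    linarith
  rw [Function.comp_apply, h2] at h1
  rw [← h1, dist_comm, ← dist_mk_lift' x _ (hm x hx), dist_comm,
    dist_eq_dist_lift (mk (m + 1) φ) (mk m (x.lift (hm x hx))) le_rfl m.le_succ, lift_mk_succ]
  exact congrArg (fun y => dist y _) (lift_mk (m + 1) φ)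

/-- Replace each point of `s` by a point of the dense subspace within `ε / 2`. This changes the
value of `f` and the distance to the new point by at most `ε / 2` each. -/
theorem exists_abs_dist_sub_le {X : Type v} {Y : Type w} [PseudoMetricSpace X]
    [PseudoMetricSpace Y] (hX : HasOnePointExtensions X) {i : X → Y} (hi : Isometry i)
    (hd : DenseRange i) {f : Y → ℝ} (hf : IsKatetov f) {s : Set Y} (hs : s.Finite) {ε : ℝ}
    (hε : 0 < ε) : ∃ z, ∀ x ∈ s, |dist z x - f x| ≤ ε := by
  choose j hj using fun y => hd.exists_dist_lt y (half_pos hε)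
  obtain ⟨z, hz⟩ := hX _ (hf.comp_isometry hi) _ (hs.image j)
  refine ⟨i z, fun x hx => ?_⟩
  have h1 := hz _ ⟨x, hx, rfl⟩
  rw [← hi.dist_eq, Function.comp_apply] at h1
  have h2 := (hf x (i (j x))).1
  have h3 := (hf (i (j x)) x).1
  have h4 := hj x
  have h5 := dist_triangle (i z) x (i (j x))
  have h6 := dist_triangle (i z) (i (j x)) x
  rw [dist_comm (i (j x)) x] at h3 h6
  rw [abs_le]
  constructor <;> linarith

/-- Adjoin `z` to `s` with the prescribed value `δ`. Because `z` realizes `f` up to `δ`, the data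
stay Katětov, and the envelope equals `f` on `s` and is at most `δ` at `z`. Realizing it up to `ε`
improves `z` by a controlled move. -/
theorem exists_approx_extension {Y : Type w} [PseudoMetricSpace Y]
    (happ : ∀ f : Y → ℝ, IsKatetov f → ∀ s : Set Y, s.Finite → ∀ ε > 0,
      ∃ z, ∀ x ∈ s, |dist z x - f x| ≤ ε)
    {f : Y → ℝ} (hf : IsKatetov f) {s : Set Y} (hs : s.Finite) (hne : s.Nonempty) {δ ε : ℝ}
    (hδ : 0 ≤ δ) (hε : 0 < ε) {z : Y} (hz : ∀ x ∈ s, |dist z x - f x| ≤ δ) :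
    ∃ z', dist z z' ≤ δ + ε ∧ ∀ x ∈ s, |dist z' x - f x| ≤ ε := by
  have := hs.to_subtype
  have := hne.to_subtype
  let q : s → Y × ℝ := fun x => (x, f x)
  let p : Option s → Y × ℝ := fun x => x.elim (z, δ) q
  have hzs : ∀ x : s, dist z x ≤ f x + δ ∧ f x ≤ dist z x + δ := fun x => by
    have := abs_le.1 (hz x x.2)
    constructor <;> linarith
  have hp : IsKatetov (katetovInf p) := by
    refine isKatetov_katetovInf ?_
    rintro (_ | x) (_ | y)
    · simp only [p, Option.elim, dist_self]
      linarith
    · simp only [p, q, Option.elim]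
      linarith [(hzs y).1]
    · simp only [p, q, Option.elim]
      rw [dist_comm]
      linarith [(hzs x).1]
    · exact (hf x y).2
  have hps : ∀ x : s, katetovInf p x = f x := by
    intro x
    refine le_antisymm ?_ ?_
    · have := katetovInf_le p (some x) x
      simpa [p, q] using this
    · obtain ⟨i, hi⟩ := exists_katetovInf_eq p x
      rw [← hi]
      rcases i with _ | y
      · simp only [p, Option.elim]
        rw [dist_comm]
        exact (hzs x).2
      · simp only [p, q, Option.elim]
        linarith [(hf x y).1]
  have hpz : katetovInf p z ≤ δ := by
    have := katetovInf_le p none z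
    simpa [p] using this
  obtain ⟨z', hz'⟩ := happ _ hp (insert z s) (hs.insert z) ε hε
  refine ⟨z', ?_, fun x hx => ?_⟩
  · have := abs_le.1 (hz' z (Set.mem_insert z s))
    rw [dist_comm]
    linarith
  · rw [← hps ⟨x, hx⟩]
    exact hz' x (Set.mem_insert_of_mem z hx)

theorem hasOnePointExtensions_of_approx {Y : Type w} [PseudoMetricSpace Y] [CompleteSpace Y]
    (happ : ∀ f : Y → ℝ, IsKatetov f → ∀ s : Set Y, s.Finite → ∀ ε > 0,
      ∃ z, ∀ x ∈ s, |dist z x - f x| ≤ ε) : HasOnePointExtensions Y := by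
  intro f hf s hs
  rcases s.eq_empty_or_nonempty with rfl | hne
  · obtain ⟨z, -⟩ := happ f hf ∅ hs 1 one_pos
    exact ⟨z, by simp⟩
  -- With errors `(1 / 2) ^ n`, the moves are at most `(1 / 2) ^ n + (1 / 2) ^ (n + 1)`, so the
  -- corrected points form a Cauchy sequence whose limit realizes `f` exactly.
  have hpos : ∀ n : ℕ, (0 : ℝ) < (1 / 2) ^ n := fun n => by positivity
  let S (n : ℕ) : Type w := {z : Y // ∀ x ∈ s, |dist z x - f x| ≤ (1 / 2) ^ n}
  have step : ∀ n (z : S n), ∃ z' : S (n + 1), dist z.1 z'.1 ≤ 2 * (1 / 2) ^ n := fun n z => by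
    obtain ⟨z', h1, h2⟩ := exists_approx_extension happ hf hs hne (hpos n).le (hpos (n + 1)) z.2
    refine ⟨⟨z', h2⟩, h1.trans ?_⟩
    rw [pow_succ]
    linarith [hpos n]
  choose next hnext using step
  obtain ⟨z₀, hz₀⟩ := happ f hf s hs _ (hpos 0)
  let z : ∀ n, S n := fun n => Nat.rec ⟨z₀, hz₀⟩ next n
  have hc : CauchySeq fun n => (z n).1 :=
    cauchySeq_of_le_geometric (1 / 2) 2 (by norm_num) fun n => hnext n (z n)
  obtain ⟨y, hy⟩ := cauchySeq_tendsto_of_complete hc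
  refine ⟨y, fun x hx => ?_⟩
  have h1 : Filter.Tendsto (fun n => |dist (z n).1 x - f x|) Filter.atTop (𝓝 |dist y x - f x|) :=
    ((hy.dist tendsto_const_nhds).sub_const _).abs
  have h2 : Filter.Tendsto (fun n : ℕ => (1 / 2 : ℝ) ^ n) Filter.atTop (𝓝 0) :=
    tendsto_pow_atTop_nhds_zero_of_lt_one (by norm_num) (by norm_num)
  have h3 := le_of_tendsto_of_tendsto' h1 h2 fun n => (z n).2 x hx
  exact sub_eq_zero.1 (abs_eq_zero.1 (le_antisymm h3 (abs_nonneg _)))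

theorem HasOnePointExtensions.completion {X : Type w} [PseudoMetricSpace X]
    (hX : HasOnePointExtensions X) : HasOnePointExtensions (UniformSpace.Completion X) :=
  hasOnePointExtensions_of_approx fun _ hf _ hs _ hε =>
    exists_abs_dist_sub_le hX UniformSpace.Completion.coe_isometry
      UniformSpace.Completion.denseRange_coe hf hs hε

/-! ### Actions on completions -/

theorem continuous_smul_left_of_dense {G : Type u} [TopologicalSpace G] {X : Type v} {Y : Type w}
    [PseudoMetricSpace Y] [SMul G Y] [IsIsometricSMul G Y] {i : X → Y} (hd : DenseRange i)
    (h : ∀ x, Continuous fun g : G => g • i x) (y : Y) : Continuous fun g : G => g • y := by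
  rw [continuous_iff_continuousAt]
  intro g₀
  rw [Metric.continuousAt_iff']
  intro ε hε
  obtain ⟨x, hx⟩ := hd.exists_dist_lt y (show 0 < ε / 3 by positivity)
  filter_upwards [Metric.continuousAt_iff'.1 (h x).continuousAt (ε / 3) (by positivity)] with g hg
  have h1 := dist_triangle4 (g • y) (g • i x) (g₀ • i x) (g₀ • y)
  rw [dist_smul, dist_smul, dist_comm (i x) y] at h1
  linarith

theorem MovesFiniteSets.of_dense {G : Type u} {X : Type v} {Y : Type w}
    [PseudoMetricSpace X] [PseudoMetricSpace Y] [SMul G X] [SMul G Y] [IsIsometricSMul G Y]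
    {i : X → Y} (hi : Isometry i) (hd : DenseRange i) (hs : ∀ (g : G) x, i (g • x) = g • i x)
    {ε : ℝ} (h : MovesFiniteSets G X ε) (hε : 0 < ε) : MovesFiniteSets G Y (ε / 2) := by
  intro s hsf
  -- Approximating both `x` and `y` costs `ε / 4` each, which leaves `ε / 2`.
  choose j hj using fun y => hd.exists_dist_lt y (show 0 < ε / 4 by positivity)
  obtain ⟨g, hg⟩ := h _ (hsf.image j)
  refine ⟨g, fun x hx y hy => ?_⟩
  have h1 := hg _ ⟨x, hx, rfl⟩ _ ⟨y, hy, rfl⟩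
  rw [← hi.dist_eq, hs] at h1
  have h2 := dist_triangle4 (i (j x)) x (g • y) (g • i (j y))
  rw [dist_smul, dist_comm _ x] at h2
  linarith [hj x, hj y]

theorem isIsometricSMul_of_dense {G : Type u} {X : Type v} {Y : Type w}
    [PseudoMetricSpace X] [PseudoMetricSpace Y] [SMul G X] [SMul G Y] [IsIsometricSMul G X]
    [ContinuousConstSMul G Y] {i : X → Y} (hi : Isometry i) (hd : DenseRange i)
    (hs : ∀ (g : G) x, i (g • x) = g • i x) : IsIsometricSMul G Y := by
  refine ⟨fun g => Isometry.of_dist_eq fun x y => ?_⟩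
  refine hd.induction_on₂ (p := fun x y => dist (g • x) (g • y) = dist x y) ?_ (fun x y => ?_) x y
  · refine isClosed_eq ?_ continuous_dist
    exact ((continuous_const_smul g).comp continuous_fst).dist
      ((continuous_const_smul g).comp continuous_snd)
  · rw [← hs, ← hs, hi.dist_eq, hi.dist_eq, dist_smul]

/-- Every separable pseudometric space with a continuous isometric action of `G` embeds
equivariantly into a complete separable metric space with one-point extensions. -/
theorem exists_equivariant_extension {G : Type u} [Group G] [TopologicalSpace G] (X : Type w)
    [PseudoMetricSpace X] [Nonempty X] [TopologicalSpace.SeparableSpace X] [MulAction G X]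
    [IsIsometricSMul G X] (hX : ∀ x : X, Continuous fun g : G => g • x) :
    ∃ (Y : Type w) (_ : MetricSpace Y) (_ : CompleteSpace Y)
      (_ : TopologicalSpace.SeparableSpace Y) (_ : MulAction G Y) (_ : IsIsometricSMul G Y),
      HasOnePointExtensions Y ∧ (∀ y : Y, Continuous fun g : G => g • y) ∧
      (∃ i : X → Y, Isometry i) ∧
      ∀ ε > 0, MovesFiniteSets G X ε → MovesFiniteSets G Y (ε / 2) := by
  -- The space `X` is only pseudometric, while the tower starts from a metric space; one preliminary
  -- Katětov step repairs this and keeps finite sets moving.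
  let T : IsometricGSpace.{u, w} G := IsometricGSpace.katetov X hX
  have hu : UniformContinuousConstSMul G T.Union :=
    ⟨fun g => (isometry_smul T.Union g).uniformContinuous⟩
  have hs : ∀ (g : G) (x : T.Union), ((g • x : T.Union) : UniformSpace.Completion T.Union) =
      g • (x : UniformSpace.Completion T.Union) := fun g x => UniformSpace.Completion.coe_smul g x
  have hiso : IsIsometricSMul G (UniformSpace.Completion T.Union) :=
    isIsometricSMul_of_dense UniformSpace.Completion.coe_isometry
      UniformSpace.Completion.denseRange_coe hs
  refine ⟨UniformSpace.Completion T.Union, inferInstance, inferInstance, inferInstance,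
    inferInstance, hiso, (IsometricGSpace.Union.hasOnePointExtensions T).completion,
    continuous_smul_left_of_dense UniformSpace.Completion.denseRange_coe fun x => ?_,
    ⟨_, (UniformSpace.Completion.coe_isometry.comp (IsometricGSpace.Union.isometry_mk 0)).comp
      (KatetovSpace.isometry_point (X := X))⟩, fun ε hε h => ?_⟩
  · simp only [← hs]
    exact (UniformSpace.Completion.continuous_coe _).comp
      (IsometricGSpace.Union.continuous_smul_left x)
  · exact (IsometricGSpace.Union.movesFiniteSets (X := T) h.katetovSpace).of_dense
      UniformSpace.Completion.coe_isometry UniformSpace.Completion.denseRange_coe hs hε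

/-! ### Back and forth -/

/-- A relation which preserves distances. -/
def IsIsometricRel {X : Type v} {Y : Type w} [PseudoMetricSpace X] [PseudoMetricSpace Y]
    (P : Set (X × Y)) : Prop :=
  ∀ p ∈ P, ∀ q ∈ P, dist p.1 q.1 = dist p.2 q.2

theorem IsIsometricRel.swap {X : Type v} {Y : Type w} [PseudoMetricSpace X] [PseudoMetricSpace Y]
    {P : Set (X × Y)} (hP : IsIsometricRel P) : IsIsometricRel (Prod.swap ⁻¹' P) :=
  fun _ hp _ hq => (hP _ hp _ hq).symm

/-- Both spaces are completions of `R` for the same pulled-back pseudometric, so uniqueness of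
completions supplies the map. -/
theorem exists_isometryEquiv_of_denseRange {R : Type u} {X : Type v} {Y : Type w} [MetricSpace X]
    [MetricSpace Y] [CompleteSpace X] [CompleteSpace Y] {i : R → X} {j : R → Y}
    (hi : DenseRange i) (hj : DenseRange j) (h : ∀ p q, dist (i p) (i q) = dist (j p) (j q)) :
    ∃ F : X ≃ᵢ Y, ∀ p, F (i p) = j p := by
  let _ : PseudoMetricSpace R := PseudoMetricSpace.induced i inferInstance
  have hi' : Isometry i := Isometry.of_dist_eq fun _ _ => rfl
  have hj' : Isometry j := Isometry.of_dist_eq fun p q => (h p q).symm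
  let A : AbstractCompletion R := ⟨X, i, inferInstance, inferInstance, inferInstance,
    hi'.isUniformInducing, hi⟩
  let B : AbstractCompletion R := ⟨Y, j, inferInstance, inferInstance, inferInstance,
    hj'.isUniformInducing, hj⟩
  let e : X ≃ᵤ Y := A.compareEquiv B
  have he : ∀ p : R, e (i p) = j p := A.compare_coe B
  have hiso : Isometry e := by
    refine Isometry.of_dist_eq fun x y => ?_
    refine hi.induction_on₂ (p := fun x y => dist (e x) (e y) = dist x y) ?_ (fun p q => ?_) x y
    · exact isClosed_eq ((e.continuous.comp continuous_fst).dist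
        (e.continuous.comp continuous_snd)) continuous_dist
    · rw [he, he, h]
  exact ⟨⟨e.toEquiv, hiso⟩, he⟩

/-- A relation which preserves distances and has dense projections to two complete metric spaces
extends to an isometry between them. -/
theorem IsIsometricRel.exists_isometryEquiv {X : Type v} {Y : Type w} [MetricSpace X]
    [MetricSpace Y] [CompleteSpace X] [CompleteSpace Y] {R : Set (X × Y)} (hR : IsIsometricRel R)
    (h1 : Dense (Prod.fst '' R)) (h2 : Dense (Prod.snd '' R)) :
    ∃ F : X ≃ᵢ Y, ∀ p ∈ R, F p.1 = p.2 := by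
  obtain ⟨F, hF⟩ := exists_isometryEquiv_of_denseRange (i := fun p : R => p.1.1)
    (j := fun p : R => p.1.2) (by rwa [DenseRange, ← Set.image_eq_range])
    (by rwa [DenseRange, ← Set.image_eq_range]) fun p q => hR _ p.2 _ q.2
  exact ⟨F, fun p hp => hF ⟨p, hp⟩⟩

/-- The point `y` must have prescribed distances to the second coordinates of `P`, namely those of
`x` to the first ones. Their lower envelope is a Katětov function on `Y` with these values. -/
theorem HasOnePointExtensions.exists_isIsometricRel_insert {X : Type v} {Y : Type w}
    [PseudoMetricSpace X] [PseudoMetricSpace Y] (hY : HasOnePointExtensions Y) [Nonempty Y]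
    {P : Set (X × Y)} (hP : IsIsometricRel P) (hfin : P.Finite) (x : X) :
    ∃ y, IsIsometricRel (insert (x, y) P) := by
  rcases P.eq_empty_or_nonempty with rfl | hne
  · refine ⟨Classical.arbitrary Y, ?_⟩
    rintro p (rfl | hp) q (rfl | hq)
    · simp
    all_goals simp_all
  have := hfin.to_subtype
  have := hne.to_subtype
  let p : P → Y × ℝ := fun i => (i.1.2, dist x i.1.1)
  have hp : IsKatetov (katetovInf p) := isKatetov_katetovInf fun i j => by
    simp only [p]
    rw [← hP _ i.2 _ j.2]
    exact dist_triangle_left _ _ _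
  obtain ⟨y, hy⟩ := hY _ hp _ (hfin.image Prod.snd)
  have key : ∀ q ∈ P, dist x q.1 = dist y q.2 := fun q hq => by
    rw [hy _ ⟨q, hq, rfl⟩]
    refine (katetovInf_apply_self (p := p) (fun i j => ?_) ⟨q, hq⟩).symm
    simp only [p]
    rw [← hP _ i.2 _ j.2, dist_comm i.1.1]
    exact dist_triangle _ _ _
  refine ⟨y, ?_⟩
  rintro q (rfl | hq) r (rfl | hr)
  · simp
  · exact key r hr
  · simpa only [dist_comm] using key q hq
  · exact hP q hq r hr

/-- Finite partial isometries between complete separable metric spaces with one-point extensions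
extend to isometries. -/
theorem IsIsometricRel.exists_isometryEquiv_of_finite {X : Type v} {Y : Type w} [MetricSpace X]
    [MetricSpace Y] [CompleteSpace X] [CompleteSpace Y] [TopologicalSpace.SeparableSpace X]
    [TopologicalSpace.SeparableSpace Y] [Nonempty X] [Nonempty Y]
    (hX : HasOnePointExtensions X) (hY : HasOnePointExtensions Y) {P : Set (X × Y)}
    (hP : IsIsometricRel P) (hfin : P.Finite) : ∃ F : X ≃ᵢ Y, ∀ p ∈ P, F p.1 = p.2 := by
  let S : Type (max v w) := {P : Set (X × Y) // IsIsometricRel P ∧ P.Finite}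
  -- Stage `n` puts the `n`-th term of each dense sequence into the domain and the range, so the
  -- union of the stages has dense projections.
  have step : ∀ (n : ℕ) (P : S), ∃ Q : S, P.1 ⊆ Q.1 ∧
      TopologicalSpace.denseSeq X n ∈ Prod.fst '' Q.1 ∧
      TopologicalSpace.denseSeq Y n ∈ Prod.snd '' Q.1 := by
    rintro n ⟨P, hP, hfin⟩
    obtain ⟨y, hy⟩ := hY.exists_isIsometricRel_insert hP hfin (TopologicalSpace.denseSeq X n)
    set P' := insert (TopologicalSpace.denseSeq X n, y) P
    have hfin' : P'.Finite := hfin.insert _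
    obtain ⟨x, hx⟩ := hX.exists_isIsometricRel_insert hy.swap
      (hfin'.preimage Prod.swap_injective.injOn) (TopologicalSpace.denseSeq Y n)
    have hsub : insert (x, TopologicalSpace.denseSeq Y n) P' =
        Prod.swap ⁻¹' (insert (TopologicalSpace.denseSeq Y n, x) (Prod.swap ⁻¹' P')) := by
      ext ⟨a, b⟩
      simp [and_comm]
    refine ⟨⟨insert (x, TopologicalSpace.denseSeq Y n) P', hsub ▸ hx.swap, hfin'.insert _⟩,
      (Set.subset_insert _ _).trans (Set.subset_insert _ _), ?_, ?_⟩
    · exact ⟨_, Set.mem_insert_of_mem _ (Set.mem_insert _ _), rfl⟩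
    · exact ⟨_, Set.mem_insert _ _, rfl⟩
  choose next hnext using step
  let Q : ℕ → S := fun n => Nat.rec ⟨P, hP, hfin⟩ next n
  have hmono : Monotone fun n => (Q n).1 := monotone_nat_of_le_succ fun n => (hnext n (Q n)).1
  have hR : IsIsometricRel (⋃ n, (Q n).1) := by
    intro p hp q hq
    obtain ⟨m, hm⟩ := Set.mem_iUnion.1 hp
    obtain ⟨n, hn⟩ := Set.mem_iUnion.1 hq
    exact (Q (max m n)).2.1 p (hmono (le_max_left m n) hm) q (hmono (le_max_right m n) hn)
  obtain ⟨F, hF⟩ := hR.exists_isometryEquiv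
    ((TopologicalSpace.denseRange_denseSeq X).mono (by
      rintro _ ⟨n, rfl⟩
      exact Set.image_mono (Set.subset_iUnion (fun n => (Q n).1) (n + 1)) (hnext n (Q n)).2.1))
    ((TopologicalSpace.denseRange_denseSeq Y).mono (by
      rintro _ ⟨n, rfl⟩
      exact Set.image_mono (Set.subset_iUnion (fun n => (Q n).1) (n + 1)) (hnext n (Q n)).2.2))
  exact ⟨F, fun p hp => hF p (Set.mem_iUnion.2 ⟨0, hp⟩)⟩

/-! ### Urysohn spaces -/

/-- The equivariant construction is used for the trivial group `PUnit`. -/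
theorem exists_isometry_hasOnePointExtensions (X : Type w) [PseudoMetricSpace X] [Nonempty X]
    [TopologicalSpace.SeparableSpace X] :
    ∃ (Y : Type w) (_ : MetricSpace Y) (_ : CompleteSpace Y)
      (_ : TopologicalSpace.SeparableSpace Y) (i : X → Y), Isometry i ∧
      HasOnePointExtensions Y := by
  let _ : MulAction PUnit.{1} X :=
    { smul := fun _ x => x
      one_smul := fun _ => rfl
      mul_smul := fun _ _ _ => rfl }
  have : IsIsometricSMul PUnit.{1} X := ⟨fun _ => isometry_id⟩
  obtain ⟨Y, _, _, _, _, _, hY, -, ⟨i, hi⟩, -⟩ := exists_equivariant_extension (G := PUnit.{1}) X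
    fun x => continuous_const (y := x)
  exact ⟨Y, inferInstance, inferInstance, inferInstance, i, hi, hY⟩

/-- `X` embeds into some complete separable space with one-point extensions, and back and forth from
the empty relation identifies that space with `Y`. -/
theorem HasOnePointExtensions.exists_isometry {Y : Type w} [MetricSpace Y] [CompleteSpace Y]
    [TopologicalSpace.SeparableSpace Y] [Nonempty Y] (hY : HasOnePointExtensions Y) (X : Type v)
    [PseudoMetricSpace X] [TopologicalSpace.SeparableSpace X] : ∃ i : X → Y, Isometry i := by
  cases isEmpty_or_nonempty X
  · exact ⟨isEmptyElim, fun x => isEmptyElim x⟩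
  obtain ⟨Z, _, _, _, i, hi, hZ⟩ := exists_isometry_hasOnePointExtensions X
  have : Nonempty Z := ⟨i (Classical.arbitrary X)⟩
  obtain ⟨F, -⟩ := IsIsometricRel.exists_isometryEquiv_of_finite hZ hY (P := ∅)
    (fun p hp => hp.elim) Set.finite_empty
  exact ⟨F ∘ i, F.isometry.comp hi⟩

theorem HasOnePointExtensions.isUrysohnSpace {Y : Type w} [MetricSpace Y] [CompleteSpace Y]
    [TopologicalSpace.SeparableSpace Y] [Nonempty Y] (hY : HasOnePointExtensions Y) :
    IsUrysohnSpace Y where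
  complete := inferInstance
  separable := inferInstance
  universal X _ _ := hY.exists_isometry X
  ultrahomogeneous A B hA _ f := by
    have := hA.to_subtype
    obtain ⟨F, hF⟩ := IsIsometricRel.exists_isometryEquiv_of_finite hY hY
      (P := Set.range fun a : A => ((a : Y), (f a : Y)))
      (by
        rintro _ ⟨a, rfl⟩ _ ⟨b, rfl⟩
        exact (f.isometry.dist_eq a b).symm)
      (Set.finite_range _)
    exact ⟨F, fun a => hF _ ⟨a, rfl⟩⟩

theorem exists_hasOnePointExtensions : ∃ (Y : Type) (_ : MetricSpace Y) (_ : CompleteSpace Y)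
    (_ : TopologicalSpace.SeparableSpace Y) (_ : Nonempty Y), HasOnePointExtensions Y := by
  obtain ⟨Y, _, _, _, i, -, hY⟩ := exists_isometry_hasOnePointExtensions PUnit.{1}
  exact ⟨Y, inferInstance, inferInstance, inferInstance, ⟨i PUnit.unit⟩, hY⟩

theorem IsUrysohnSpace.nonempty {U : Type v} [MetricSpace U] (hU : IsUrysohnSpace U) :
    Nonempty U := by
  obtain ⟨i, -⟩ := hU.universal PUnit.{1}
  exact ⟨i PUnit.unit⟩

/-- Take a copy `i` in `U` of a space `Y` with one-point extensions; it contains a copy of `s`.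
Ultrahomogeneity gives an isometry `F` of `U` carrying this copy onto `s`, and `F ∘ i` transports
the solution found in `Y`. The space `Y` lives in `Type` because universality is stated there. -/
theorem IsUrysohnSpace.hasOnePointExtensions {U : Type v} [MetricSpace U]
    (hU : IsUrysohnSpace U) : HasOnePointExtensions U := by
  obtain ⟨Y, _, _, _, _, hY⟩ := exists_hasOnePointExtensions
  obtain ⟨i, hi⟩ := hU.universal Y
  intro f hf s hs
  have := hs.to_subtype
  obtain ⟨j, hj⟩ := hY.exists_isometry s
  have hij : Isometry (i ∘ j) := hi.comp hj
  obtain ⟨F, hF⟩ := hU.ultrahomogeneous (Set.range (i ∘ j)) s (Set.finite_range _) hs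
    hij.isometryEquivOnRange.symm
  have hF' : ∀ a : s, F (i (j a)) = a := fun a => by
    rw [hF ⟨i (j a), a, rfl⟩]
    exact congrArg Subtype.val (hij.isometryEquivOnRange.symm_apply_apply a)
  obtain ⟨z, hz⟩ := hY _ (hf.comp_isometry (F.isometry.comp hi)) _ (Set.finite_range j)
  refine ⟨F (i z), fun x hx => ?_⟩
  have h1 := hz _ ⟨⟨x, hx⟩, rfl⟩
  simp only [Function.comp_apply] at h1
  rw [hF'] at h1
  rw [← h1, ← hi.dist_eq z, ← F.isometry.dist_eq (i z), hF']

/-- Continuous isometric actions on separable spaces that move finite sets give such actions on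
every Urysohn space. -/
theorem IsUrysohnSpace.exists_movesFiniteSets {G : Type u} [Group G] [TopologicalSpace G]
    {U : Type v} [MetricSpace U] (hU : IsUrysohnSpace U) (X : Type w)
    [PseudoMetricSpace X] [Nonempty X] [TopologicalSpace.SeparableSpace X] [MulAction G X]
    [IsIsometricSMul G X] (hX : ∀ x : X, Continuous fun g : G => g • x) {ε : ℝ} (hε : 0 < ε)
    (hm : MovesFiniteSets G X ε) :
    ∃ (_ : MulAction G U) (_ : IsIsometricSMul G U), (∀ x : U, Continuous fun g : G => g • x) ∧
      MovesFiniteSets G U (ε / 2) := by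
  obtain ⟨Y, _, _, _, _, _, hY, hc, ⟨i, -⟩, hmY⟩ := exists_equivariant_extension (G := G) X hX
  have : Nonempty Y := ⟨i (Classical.arbitrary X)⟩
  have := hU.nonempty
  have := hU.complete
  have := hU.separable
  obtain ⟨F, -⟩ := IsIsometricRel.exists_isometryEquiv_of_finite hU.hasOnePointExtensions hY
    (P := ∅) (fun p hp => hp.elim) Set.finite_empty
  -- The action on `Y` is conjugated by the isometry `F`.
  let : MulAction G U :=
    { smul := fun g x => F.symm (g • F x)
      one_smul := fun x => by
        change F.symm ((1 : G) • F x) = x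
        rw [one_smul, F.symm_apply_apply]
      mul_smul := fun g h x => by
        change F.symm ((g * h) • F x) = F.symm (g • F (F.symm (h • F x)))
        rw [F.apply_symm_apply, mul_smul] }
  have hs : ∀ (g : G) (x : U), g • x = F.symm (g • F x) := fun _ _ => rfl
  refine ⟨inferInstance, ⟨fun g => ?_⟩, fun x => ?_, fun s hfin => ?_⟩
  · exact F.symm.isometry.comp ((isometry_smul Y g).comp F.isometry)
  · exact F.symm.continuous.comp (hc (F x))
  · obtain ⟨g, hg⟩ := hmY ε hε hm _ (hfin.image F)
    refine ⟨g, fun x hx y hy => ?_⟩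
    rw [hs, ← F.isometry.dist_eq, F.apply_symm_apply]
    exact hg _ ⟨x, hx, rfl⟩ _ ⟨y, hy, rfl⟩

/-! ### Precompactness and two-sided translates -/

/-- A version of B. H. Neumann's lemma on coverings by cosets, for arbitrary subsets. -/
theorem exists_finite_mul_mul_inv_eq_univ {G : Type u} [Group G] {ι : Type*} (A : ι → Set G)
    (s : Finset ι) (F : ι → Set G) (hF : ∀ i, (F i).Finite)
    (h : ∀ g, ∃ i ∈ s, g ∈ F i * A i) :
    ∃ i ∈ s, ∃ T : Set G, T.Finite ∧ T * (A i * (A i)⁻¹) = Set.univ := by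
  classical
  induction s using Finset.induction_on generalizing F with
  | empty => simpa using h 1
  | insert a s ha ih =>
    by_cases hc : F a * (A a * (A a)⁻¹) = Set.univ
    · exact ⟨a, Finset.mem_insert_self _ _, F a, hF a, hc⟩
    obtain ⟨x, hx⟩ := (Set.ne_univ_iff_exists_notMem _).1 hc
    -- Since `x` is outside `F a * (A a * (A a)⁻¹)`, the translate of `A a` by `x` misses `F a * A
    -- a` and is covered by the other sets. Translating back, `F a * A a` is covered by the sets `F
    -- a * {x⁻¹} * F j * A j`, and `a` can be dropped.
    have hdisj : ∀ b ∈ A a, x * b ∉ F a * A a := by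
      rintro b hb ⟨f, hf, c, hca, hfc⟩
      refine hx ⟨f, hf, c * b⁻¹, Set.mul_mem_mul hca (Set.inv_mem_inv.2 hb), ?_⟩
      change f * c = x * b at hfc
      change f * (c * b⁻¹) = x
      rw [← mul_assoc, hfc, mul_inv_cancel_right]
    obtain ⟨i, hi, T, hT⟩ := ih (fun i => F i ∪ F a * {x⁻¹} * F i)
      (fun i => (hF i).union (((hF a).mul (Set.finite_singleton _)).mul (hF i))) (fun g => by
        obtain ⟨i, hi, hg⟩ := h g
        rcases Finset.mem_insert.1 hi with rfl | hi
        · obtain ⟨f, hf, b, hb, rfl⟩ := hg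
          obtain ⟨j, hj, hbj⟩ := h (x * b)
          rcases Finset.mem_insert.1 hj with rfl | hj
          · exact (hdisj b hb hbj).elim
          · obtain ⟨f', hf', c, hc, hfc⟩ := hbj
            refine ⟨j, hj, f * x⁻¹ * f', Or.inr ?_, c, hc, ?_⟩
            · exact Set.mul_mem_mul (Set.mul_mem_mul hf rfl) hf'
            · change f' * c = x * b at hfc
              change f * x⁻¹ * f' * c = f * b
              rw [mul_assoc, hfc]
              group
        · exact ⟨i, hi, Set.mul_subset_mul_right Set.subset_union_left hg⟩)
    exact ⟨i, Finset.mem_insert_of_mem hi, T, hT⟩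

/-- If `F * V * F⁻¹` were everything, finitely many left translates of the sets `V * {f⁻¹}` would
cover `G`. The covering lemma then gives a finite `T` with `T * (V * V⁻¹) = univ`, as `f` cancels,
while `V * V⁻¹` lies in a translate of `U`. -/
theorem exists_nhds_one_mul_mul_inv_ne_univ {G : Type u} [Group G] [TopologicalSpace G]
    [IsTopologicalGroup G] (hG : ¬ IsPrecompactGroup G) :
    ∃ V ∈ 𝓝 (1 : G), ∀ F : Set G, F.Finite → F * V * F⁻¹ ≠ Set.univ := by
  simp only [IsPrecompactGroup, not_forall] at hG
  obtain ⟨U, hU, ⟨u, hu⟩, hcov⟩ := hG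
  have hU' : (u * ·) ⁻¹' U ∈ 𝓝 (1 : G) :=
    (hU.preimage (continuous_const_mul u)).mem_nhds (by simpa using hu)
  obtain ⟨V, hV, hVU⟩ := exists_nhds_split_inv hU'
  refine ⟨V, hV, fun F hF hFV => hcov ?_⟩
  obtain ⟨i, -, T, hT, hTV⟩ := exists_finite_mul_mul_inv_eq_univ (fun f : G => V * {f⁻¹})
    hF.toFinset (fun _ => F) (fun _ => hF) (fun g => by
      have hg : g ∈ F * V * F⁻¹ := hFV ▸ Set.mem_univ g
      obtain ⟨_, ⟨f, hf, v, hv, rfl⟩, f', hf', rfl⟩ := hg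
      refine ⟨f'⁻¹, by simpa using hf', f, hf, v * f', ?_, (mul_assoc _ _ _).symm⟩
      exact Set.mul_mem_mul hv (by simp))
  refine ⟨T * {u⁻¹}, hT.mul (Set.finite_singleton _), Set.eq_univ_of_forall fun g => ?_⟩
  have hg : g ∈ T * (V * {i⁻¹} * (V * {i⁻¹})⁻¹) := hTV ▸ Set.mem_univ g
  obtain ⟨t, ht, _, ⟨_, ⟨v, hv, _, rfl, rfl⟩, w, hw, rfl⟩, rfl⟩ := hg
  obtain ⟨v', hv', _, rfl, hw⟩ := hw
  change v' * i⁻¹ = w⁻¹ at hw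
  refine ⟨t * u⁻¹, Set.mul_mem_mul ht rfl, u * (v / v'), hVU v hv v' hv', ?_⟩
  rw [← inv_inv w, ← hw, div_eq_mul_inv]
  group

theorem isOmegaBoundedGroup_of_separableSpace {G : Type u} [Group G] [TopologicalSpace G]
    [IsTopologicalGroup G] [TopologicalSpace.SeparableSpace G] : IsOmegaBoundedGroup G := by
  intro V hV hne
  obtain ⟨D, hD, hDd⟩ := TopologicalSpace.exists_countable_dense G
  refine ⟨D, hD, Set.eq_univ_of_forall fun g => ?_⟩
  obtain ⟨v, hv⟩ := hne
  have ho : IsOpen ((fun d : G => d⁻¹ * g) ⁻¹' V) := hV.preimage (by fun_prop)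
  obtain ⟨d, hd, hdD⟩ := hDd.inter_open_nonempty _ ho ⟨g * v⁻¹, by simpa using hv⟩
  exact ⟨d, hdD, d⁻¹ * g, hd, by simp⟩

/-! ### Left-invariant pseudometrics -/

/-- Triple products are required because the chain argument for pseudometrics compares `d x₁ x₄`
with three consecutive steps. -/
theorem exists_seq_nhds_one {G : Type u} [Group G] [TopologicalSpace G] [IsTopologicalGroup G]
    {V : Set G} (hV : V ∈ 𝓝 (1 : G)) :
    ∃ W : ℕ → Set G, W 0 ⊆ V ∧ (∀ n, W n ∈ 𝓝 1) ∧ (∀ n g, g ∈ W n → g⁻¹ ∈ W n) ∧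
      ∀ n a b c, a ∈ W (n + 1) → b ∈ W (n + 1) → c ∈ W (n + 1) → a * b * c ∈ W n := by
  let S : Type u := {W : Set G // W ∈ 𝓝 1 ∧ ∀ g ∈ W, g⁻¹ ∈ W}
  have hS : ∀ U ∈ 𝓝 (1 : G), ∃ W : S, ∀ a ∈ W.1, ∀ b ∈ W.1, ∀ c ∈ W.1, a * b * c ∈ U := by
    intro U hU
    obtain ⟨W, hW, hWU⟩ := exists_nhds_one_split4 hU
    refine ⟨⟨W ∩ W⁻¹, Filter.inter_mem hW (inv_mem_nhds_one G hW), fun g hg => ⟨hg.2, ?_⟩⟩, ?_⟩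
    · simpa using hg.1
    · intro a ha b hb c hc
      simpa using hWU ha.1 hb.1 hc.1 (mem_of_mem_nhds hW)
  choose next hnext using fun W : S => hS W.1 W.2.1
  obtain ⟨W₀, hW₀⟩ := hS V hV
  let W : ℕ → S := fun n => Nat.rec W₀ (fun _ => next) n
  have h1 : ∀ n, (1 : G) ∈ (W n).1 := fun n => mem_of_mem_nhds (W n).2.1
  refine ⟨fun n => (W n).1, fun g hg => ?_, fun n => (W n).2.1, fun n => (W n).2.2,
    fun n a b c ha hb hc => hnext (W n) a ha b hb c hc⟩
  simpa using hW₀ g hg 1 (h1 0) 1 (h1 0)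

/-- The left-invariant version of the metrization theorem for uniform spaces. -/
theorem exists_leftInvariant_pseudoMetric {G : Type u} [Group G] [TopologicalSpace G]
    [IsTopologicalGroup G] {V : Set G} (hV : V ∈ 𝓝 (1 : G)) :
    ∃ d : G → G → ℝ, (∀ x, d x x = 0) ∧ (∀ x y, d x y = d y x) ∧
      (∀ x y z, d x z ≤ d x y + d y z) ∧ (∀ g x y, d (g * x) (g * y) = d x y) ∧
      (∀ ε > 0, {g | d 1 g < ε} ∈ 𝓝 (1 : G)) ∧ ∃ ε > 0, ∀ g, d 1 g < ε → g ∈ V := by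
  classical
  obtain ⟨W, hWV, hW1, hWsymm, hWmul⟩ := exists_seq_nhds_one hV
  have hanti : Antitone W := antitone_nat_of_succ_le fun n g hg => by
    simpa using hWmul n g 1 1 hg (mem_of_mem_nhds (hW1 _)) (mem_of_mem_nhds (hW1 _))
  -- The value is `(1 / 2) ^ n` for the first `n` with `x⁻¹ * y ∉ W n`, and it depends only on `x⁻¹
  -- * y`. The pseudometric `I` is the infimum of the sums of `d` along chains, and is comparable to
  -- `d` within a factor `2`.
  let d : G → G → NNReal := fun x y =>
    if h : ∃ n, x⁻¹ * y ∉ W n then (1 / 2) ^ Nat.find h else 0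
  have hr : (1 / 2 : NNReal) ∈ Set.Ioo (0 : NNReal) 1 :=
    ⟨half_pos one_pos, NNReal.half_lt_self one_ne_zero⟩
  have hd_self : ∀ x, d x x = 0 := fun x => by
    refine dif_neg ?_
    simpa using fun n => mem_of_mem_nhds (hW1 n)
  have hd_symm : ∀ x y, d x y = d y x := fun x y => by
    have : ∀ n, x⁻¹ * y ∈ W n ↔ y⁻¹ * x ∈ W n := fun n =>
      ⟨fun h => by simpa using hWsymm n _ h, fun h => by simpa using hWsymm n _ h⟩
    simp only [d, this]
  have hle_d : ∀ {x y : G} {n : ℕ}, (1 / 2) ^ n ≤ d x y ↔ x⁻¹ * y ∉ W n := by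
    intro x y n
    dsimp only [d]
    split_ifs with h
    · rw [(pow_right_strictAnti₀ hr.1 hr.2).le_iff_ge, Nat.find_le_iff]
      exact ⟨fun ⟨m, hmn, hm⟩ hn => hm (hanti hmn hn), fun h => ⟨n, le_rfl, h⟩⟩
    · push Not at h
      simp only [h, not_true, (pow_pos hr.1 _).not_ge]
  have hd_inv : ∀ g x y, d (g * x) (g * y) = d x y := fun g x y => by
    have : (g * x)⁻¹ * (g * y) = x⁻¹ * y := by group
    simp only [d, this]
  let I := PseudoMetricSpace.ofPreNNDist d hd_self hd_symm
  have hdist_le : ∀ x y, I.dist x y ≤ d x y := PseudoMetricSpace.dist_ofPreNNDist_le _ _ _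
  have hd_le : ∀ x y, ↑(d x y) ≤ 2 * I.dist x y := by
    refine PseudoMetricSpace.le_two_mul_dist_ofPreNNDist _ _ _ fun x₁ x₂ x₃ x₄ => ?_
    by_cases H : ∃ n, x₁⁻¹ * x₄ ∉ W n
    · refine (dif_pos H).trans_le ?_
      rw [← div_le_iff₀' zero_lt_two, ← mul_one_div (_ ^ _), ← pow_succ]
      simp only [le_max_iff, hle_d, ← not_and_or]
      rintro ⟨h₁₂, h₂₃, h₃₄⟩
      refine Nat.find_spec H ?_
      have := hWmul _ _ _ _ h₁₂ h₂₃ h₃₄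
      rwa [show x₁⁻¹ * x₂ * (x₂⁻¹ * x₃) * (x₃⁻¹ * x₄) = x₁⁻¹ * x₄ by group] at this
    · exact (dif_neg H).trans_le zero_le
  refine ⟨I.dist, I.dist_self, I.dist_comm, I.dist_triangle, fun g x y => ?_, fun ε hε => ?_,
    1 / 2, by norm_num, fun g hg => hWV ?_⟩
  · change ((⨅ l : List G, ((g * x :: l).zipWith d (l ++ [g * y])).sum : NNReal) : ℝ) =
      (⨅ l : List G, ((x :: l).zipWith d (l ++ [y])).sum : NNReal)
    congr 1
    symm
    -- Left translation by `g` permutes the chains and preserves their `d`-lengths.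
    refine (List.map_surjective_iff.2 (Group.mulLeft_bijective g).2).iInf_congr _ fun l => ?_
    have h1 : g * x :: l.map (g * ·) = (x :: l).map (g * ·) := rfl
    have h2 : l.map (g * ·) ++ [g * y] = (l ++ [y]).map (g * ·) := by simp
    rw [h1, h2, List.zipWith_map]
    simp only [hd_inv]
  · obtain ⟨n, hn⟩ := exists_pow_lt_of_lt_one hε (show (1 / 2 : ℝ) < 1 by norm_num)
    refine Filter.mem_of_superset (hW1 n) fun g hg => (hdist_le 1 g).trans_lt (lt_trans ?_ hn)
    have : d 1 g < (1 / 2) ^ n := lt_of_not_ge fun h => hle_d.1 h (by simpa using hg)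
    exact_mod_cast this
  -- Outside `W 0` the value of `d 1 g` is at least `1`, hence the distance is at least `1 / 2`.
  · by_contra hgW
    have h1 : (1 / 2 : NNReal) ^ 0 ≤ d 1 g := hle_d.2 (by simpa using hgW)
    have h2 := hd_le 1 g
    have h3 : (1 : ℝ) ≤ d 1 g := by exact_mod_cast h1
    linarith

/-- A copy of the group `G`, to be endowed with a pseudometric. -/
@[ext]
structure GroupCopy (G : Type u) : Type u where
  val : G

instance {G : Type u} [Group G] : MulAction G (GroupCopy G) where
  smul g x := ⟨g * x.val⟩
  one_smul x := GroupCopy.ext (one_mul x.val)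
  mul_smul g h x := GroupCopy.ext (mul_assoc g h x.val)

/-- A non-precompact ω-bounded group has a continuous isometric action on a separable space that
moves finite sets. -/
theorem IsOmegaBoundedGroup.exists_movesFiniteSets {G : Type u} [Group G] [TopologicalSpace G]
    [IsTopologicalGroup G] (hb : IsOmegaBoundedGroup G) (hG : ¬ IsPrecompactGroup G) :
    ∃ (X : Type u) (_ : PseudoMetricSpace X) (_ : Nonempty X)
      (_ : TopologicalSpace.SeparableSpace X) (_ : MulAction G X) (_ : IsIsometricSMul G X),
      (∀ x : X, Continuous fun g : G => g • x) ∧ ∃ ε > 0, MovesFiniteSets G X ε := by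
  obtain ⟨V, hV, hVF⟩ := exists_nhds_one_mul_mul_inv_ne_univ hG
  obtain ⟨d, hd0, hdsymm, hdtri, hdinv, hd1, ε, hε, hdV⟩ := exists_leftInvariant_pseudoMetric hV
  let _ : PseudoMetricSpace (GroupCopy G) :=
    { dist := fun x y => d x.val y.val
      dist_self := fun x => hd0 x.val
      dist_comm := fun x y => hdsymm x.val y.val
      dist_triangle := fun x y z => hdtri x.val y.val z.val }
  have hdist : ∀ x y : GroupCopy G, dist x y = d 1 (x.val⁻¹ * y.val) := fun x y => by
    rw [← hdinv x.val]
    simp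
    rfl
  have hiso : IsIsometricSMul G (GroupCopy G) :=
    ⟨fun g => Isometry.of_dist_eq fun x y => hdinv g x.val y.val⟩
  have hcont : ∀ x : GroupCopy G, Continuous fun g : G => g • x := by
    intro x
    refine continuous_iff_continuousAt.2 fun g => Metric.continuousAt_iff'.2 fun δ hδ => ?_
    have h1 : Filter.Tendsto (fun h : G => (g * x.val)⁻¹ * (h * x.val)) (𝓝 g) (𝓝 1) := by
      have : Continuous fun h : G => (g * x.val)⁻¹ * (h * x.val) := by fun_prop
      simpa using this.tendsto g
    filter_upwards [h1 (hd1 δ hδ)] with h hh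
    rw [dist_comm, hdist]
    exact hh
  have hsep : TopologicalSpace.SeparableSpace (GroupCopy G) := by
    -- By ω-boundedness, countably many translates of each ball of radius `1 / (n + 1)` cover `G`;
    -- their centres form a countable dense set.
    have hcov : ∀ n : ℕ, ∃ S : Set G, S.Countable ∧ ∀ g, ∃ s ∈ S, d s g < 1 / (n + 1) := by
      intro n
      have hpos : (0 : ℝ) < 1 / (n + 1) := Nat.one_div_pos_of_nat
      obtain ⟨S, hS, hSV⟩ := hb (interior {g | d 1 g < 1 / (n + 1)}) isOpen_interior
        ⟨1, mem_interior_iff_mem_nhds.2 (hd1 _ hpos)⟩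
      refine ⟨S, hS, fun g => ?_⟩
      have hg : g ∈ S * interior {g | d 1 g < 1 / (n + 1)} := hSV ▸ Set.mem_univ g
      obtain ⟨s, hs, v, hv, rfl⟩ := hg
      refine ⟨s, hs, ?_⟩
      have h1 := hdinv s 1 v
      rw [mul_one] at h1
      change d s (s * v) < _
      rw [h1]
      exact interior_subset (s := {g | d 1 g < 1 / ((n : ℝ) + 1)}) hv
    choose S hS hSd using hcov
    refine ⟨⟨GroupCopy.mk '' ⋃ n, S n, (Set.countable_iUnion hS).image _, ?_⟩⟩
    refine Metric.dense_iff.2 fun x r hr => ?_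
    obtain ⟨n, hn⟩ := exists_nat_one_div_lt hr
    obtain ⟨s, hs, hsx⟩ := hSd n x.val
    exact ⟨⟨s⟩, hsx.trans hn, s, Set.mem_iUnion.2 ⟨n, hs⟩, rfl⟩
  refine ⟨GroupCopy G, inferInstance, ⟨⟨1⟩⟩, hsep, inferInstance, hiso, hcont, ε, hε, ?_⟩
  intro s hs
  -- If `x` and `g • y` were closer than `ε`, then `x⁻¹ * g * y` would lie in `V`, putting `g` in `F
  -- * V * F⁻¹` for the finite set `F` of values of `s`.
  obtain ⟨g, hg⟩ := (Set.ne_univ_iff_exists_notMem _).1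
    (hVF _ (hs.image GroupCopy.val))
  refine ⟨g, fun x hx y hy => le_of_not_gt fun hlt => hg ?_⟩
  rw [hdist] at hlt
  refine ⟨_, ⟨x.val, ⟨x, hx, rfl⟩, _, hdV _ hlt, rfl⟩, y.val⁻¹, by simpa using ⟨y, hy, rfl⟩, ?_⟩
  change x.val * (x.val⁻¹ * (g * y.val)) * y.val⁻¹ = g
  group

/-! ### Isometric actions on free Banach spaces -/

namespace FreeNormedSpace

variable {X : Type w} {o : X}

theorem point_self : point o o = 0 := dif_pos rfl

theorem point_of_ne {x : X} (h : x ≠ o) :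
    point o x = (coords X o).symm (Finsupp.single ⟨x, h⟩ 1) := dif_neg h

/-- The linear map sending each point `x` to `F x - F o`. -/
noncomputable def lift {V : Type*} [AddCommGroup V] [Module ℝ V] (o : X) (F : X → V) :
    FreeNormedSpace X o →ₗ[ℝ] V :=
  (Finsupp.linearCombination ℝ fun x : {x // x ≠ o} => F x - F o) ∘ₗ (coords X o).toLinearMap

section lift

variable {V : Type*} [AddCommGroup V] [Module ℝ V]

theorem lift_apply (F : X → V) (v : FreeNormedSpace X o) :
    lift o F v = (coords X o v).sum fun x c => c • (F x - F o) := rfl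

theorem lift_point (F : X → V) (x : X) : lift o F (point o x) = F x - F o := by
  by_cases h : x = o
  · rw [h, point_self, map_zero, sub_self]
  · rw [point_of_ne h, lift_apply, LinearEquiv.apply_symm_apply]
    simp

theorem linearMap_ext {f g : FreeNormedSpace X o →ₗ[ℝ] V}
    (h : ∀ x, f (point o x) = g (point o x)) : f = g := by
  have : f ∘ₗ (coords X o).symm.toLinearMap = g ∘ₗ (coords X o).symm.toLinearMap := by
    refine Finsupp.lhom_ext' fun x => LinearMap.ext_ring ?_
    have := h x.1
    rwa [point_of_ne x.2] at this
  ext v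
  simpa using LinearMap.congr_fun this (coords X o v)

theorem lift_eq_zero {F : X → V} {v : FreeNormedSpace X o}
    (h : ∀ x ∈ (coords X o v).support, F x = F o) : lift o F v = 0 := by
  rw [lift_apply]
  refine Finset.sum_eq_zero fun x hx => ?_
  simp only [h x hx, sub_self, smul_zero]

end lift

section Action

variable {G : Type u} [Group G] [MulAction G X]

/-- The linear part of the action of `G` on `L(X, o)`. -/
noncomputable def linearPart (o : X) (g : G) : FreeNormedSpace X o →ₗ[ℝ] FreeNormedSpace X o :=
  lift o fun x => point o (g • x)

theorem linearPart_point (g : G) (x : X) :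
    linearPart o g (point o x) = point o (g • x) - point o (g • o) := lift_point _ x

theorem linearPart_mul (g h : G) :
    linearPart o (g * h) = linearPart o g ∘ₗ linearPart o h := by
  refine linearMap_ext fun x => ?_
  simp only [LinearMap.comp_apply, linearPart_point, map_sub, mul_smul]
  abel

theorem linearPart_one : linearPart o (1 : G) = LinearMap.id := by
  refine linearMap_ext fun x => ?_
  rw [linearPart_point, one_smul, one_smul, point_self, sub_zero, LinearMap.id_apply]

theorem lift_linearPart {V : Type*} [AddCommGroup V] [Module ℝ V] (F : X → V) (g : G)
    (v : FreeNormedSpace X o) : lift o F (linearPart o g v) = lift o (fun x => F (g • x)) v := by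
  refine LinearMap.congr_fun (f := lift o F ∘ₗ linearPart o g) (linearMap_ext fun x => ?_) v
  simp only [LinearMap.comp_apply, linearPart_point, map_sub, lift_point]
  abel

noncomputable def linearPartEquiv (o : X) (g : G) :
    FreeNormedSpace X o ≃ₗ[ℝ] FreeNormedSpace X o :=
  LinearEquiv.ofLinearMap (linearPart o g) (linearPart o g⁻¹)
    (by rw [← linearPart_mul, mul_inv_cancel, linearPart_one])
    (by rw [← linearPart_mul, inv_mul_cancel, linearPart_one])

/-- The affine action of `G` on `L(X, o)` that extends its action on `X`. -/
noncomputable def affineMap (g : G) (v : FreeNormedSpace X o) : FreeNormedSpace X o :=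
  point o (g • o) + linearPart o g v

theorem affineMap_mul (g h : G) (v : FreeNormedSpace X o) :
    affineMap (g * h) v = affineMap g (affineMap h v) := by
  simp only [affineMap, linearPart_mul, LinearMap.comp_apply, map_add, linearPart_point, mul_smul]
  abel

end Action

variable [MetricSpace X]

/-- The pullback of the norm of `V` is one of the prenorms over which the norm of `L(X, o)` is the
largest. -/
theorem norm_lift_le {V : Type*} [SeminormedAddCommGroup V] [NormedSpace ℝ V] {F : X → V}
    (hF : ∀ x y, dist (F x) (F y) ≤ dist x y) (v : FreeNormedSpace X o) :
    ‖lift o F v‖ ≤ ‖v‖ := by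
  have h : (normSeminorm ℝ V).comp (lift o F) ∈ boundedPrenorms X o := fun x y => by
    rw [Seminorm.comp_apply, map_sub, lift_point, lift_point, sub_sub_sub_cancel_right,
      coe_normSeminorm, ← dist_eq_norm]
    exact hF x y
  exact (isGreatest_maxPrenorm X o).2 h v

theorem dist_point_le (x y : X) : dist (point o x) (point o y) ≤ dist x y := by
  rw [dist_eq_norm]
  exact (isGreatest_maxPrenorm X o).1 x y

section Action

variable {G : Type u} [Group G] [MulAction G X]

/-- Moving finite sets passes from a pointed metric space to its free normed space. -/
theorem exists_le_dist_affineMap {ε : ℝ} (h : MovesFiniteSets G X ε) (hε : 0 < ε)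
    {s : Set (FreeNormedSpace X o)} (hs : s.Finite) :
    ∃ g : G, ∀ v ∈ s, ∀ w ∈ s, ε ≤ dist v (affineMap g w) := by
  set S : Set X := insert o (⋃ v ∈ s, Subtype.val '' ((coords X o v).support : Set {x // x ≠ o}))
  have hoS : o ∈ S := Set.mem_insert _ _
  have hS : ∀ v ∈ s, ∀ x ∈ (coords X o v).support, (x : X) ∈ S := fun v hv x hx =>
    Set.mem_insert_of_mem _ (Set.mem_biUnion hv ⟨x, hx, rfl⟩)
  obtain ⟨g, hg⟩ := h S ((hs.biUnion fun v _ => (Finset.finite_toSet _).image _).insert o)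
  -- This 1-Lipschitz function vanishes on `S` and equals `ε` on the translate of `S` by `g`. Its
  -- linear extension therefore has norm at most `1`, is `0` on `s` and `ε` on the translate of `s`;
  -- the point `o` is put into `S` to account for the translation part.
  let f : X → ℝ := fun z => min (Metric.infDist z S) ε
  have hf : ∀ x y, dist (f x) (f y) ≤ dist x y := by
    have := (Metric.lipschitz_infDist_pt S).min_const ε
    simpa using fun x y => this.dist_le_mul x y
  have hf0 : ∀ x ∈ S, f x = 0 := fun x hx => by
    simp only [f, Metric.infDist_zero_of_mem hx, min_eq_left hε.le]
  have hfg : ∀ x ∈ S, f (g • x) = ε := fun x hx => by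
    refine min_eq_right ((Metric.le_infDist ⟨o, hoS⟩).2 fun y hy => ?_)
    rw [dist_comm]
    exact hg y hy x hx
  refine ⟨g, fun v hv w hw => ?_⟩
  have h1 : lift o f v = 0 := lift_eq_zero fun x hx => by rw [hf0 _ (hS v hv x hx), hf0 o hoS]
  have h2 : lift o f (affineMap g w) = ε := by
    rw [affineMap, map_add, lift_point, lift_linearPart, hfg o hoS, hf0 o hoS,
      lift_eq_zero fun x hx => by rw [hfg _ (hS w hw x hx), hfg o hoS]]
    simp
  have h3 := norm_lift_le hf (affineMap g w - v)
  rw [map_sub, h1, h2, sub_zero, Real.norm_of_nonneg hε.le] at h3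
  rwa [dist_comm, dist_eq_norm]

theorem continuous_linearPart [TopologicalSpace G]
    (hX : ∀ x : X, Continuous fun g : G => g • x) (v : FreeNormedSpace X o) :
    Continuous fun g : G => linearPart o g v := by
  have hp : Continuous (point o : X → FreeNormedSpace X o) :=
    (LipschitzWith.of_dist_le_mul (K := 1) fun x y => by
      simpa using dist_point_le (o := o) x y).continuous
  simp only [linearPart, lift_apply]
  exact continuous_finsetSum _ fun x _ =>
    (continuous_const_smul (coords X o v x)).comp ((hp.comp (hX x)).sub (hp.comp (hX o)))

theorem continuous_affineMap [TopologicalSpace G]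
    (hX : ∀ x : X, Continuous fun g : G => g • x) (v : FreeNormedSpace X o) :
    Continuous fun g : G => affineMap g v := by
  have hp : Continuous (point o : X → FreeNormedSpace X o) :=
    (LipschitzWith.of_dist_le_mul (K := 1) fun x y => by
      simpa using dist_point_le (o := o) x y).continuous
  exact (hp.comp (hX o)).add (continuous_linearPart hX v)

variable [IsIsometricSMul G X]

theorem norm_linearPart_le (g : G) (v : FreeNormedSpace X o) : ‖linearPart o g v‖ ≤ ‖v‖ :=
  norm_lift_le (fun x y => (dist_point_le _ _).trans (dist_smul g x y).le) v

theorem norm_linearPart (g : G) (v : FreeNormedSpace X o) : ‖linearPart o g v‖ = ‖v‖ := by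
  refine le_antisymm (norm_linearPart_le g v) ?_
  have := norm_linearPart_le g⁻¹ (linearPart o g v)
  rwa [← LinearMap.comp_apply, ← linearPart_mul, inv_mul_cancel, linearPart_one] at this

end Action

end FreeNormedSpace

namespace FreeBanachSpace

open FreeNormedSpace

variable {X : Type w} [MetricSpace X] {o : X} {G : Type u} [Group G] [MulAction G X]
  [IsIsometricSMul G X]

noncomputable def linearIsometry (o : X) (g : G) :
    FreeBanachSpace X o ≃ₗᵢ[ℝ] FreeBanachSpace X o :=
  (linearPartEquiv o g).extendOfIsometry UniformSpace.Completion.toComplₗᵢ.toLinearMap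
    UniformSpace.Completion.toComplₗᵢ.toLinearMap UniformSpace.Completion.denseRange_coe
    UniformSpace.Completion.denseRange_coe fun v => by
      simp only [LinearIsometry.coe_toLinearMap, LinearIsometry.norm_map]
      exact norm_linearPart g v

theorem linearIsometry_coe (g : G) (v : FreeNormedSpace X o) :
    linearIsometry o g (v : FreeBanachSpace X o) = (linearPart o g v : FreeNormedSpace X o) :=
  LinearEquiv.extendOfIsometry_eq _ _ _ _ _ _ v

noncomputable def affineIsometry (o : X) (g : G) :
    FreeBanachSpace X o ≃ᵃⁱ[ℝ] FreeBanachSpace X o :=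
  (linearIsometry o g).toAffineIsometryEquiv.trans
    (AffineIsometryEquiv.constVAdd ℝ (FreeBanachSpace X o)
      (point o (g • o) : FreeBanachSpace X o))

theorem affineIsometry_coe (g : G) (v : FreeNormedSpace X o) :
    affineIsometry o g (v : FreeBanachSpace X o) = (affineMap g v : FreeNormedSpace X o) := by
  rw [affineMap, UniformSpace.Completion.coe_add, ← linearIsometry_coe]
  rfl

/-- The affine isometric action of `G` on `B(X, o)` that extends its action on `X`. -/
noncomputable def affineAction (G : Type u) [Group G] [MulAction G X] [IsIsometricSMul G X]
    (o : X) : G →* (FreeBanachSpace X o ≃ᵃⁱ[ℝ] FreeBanachSpace X o) :=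
  MonoidHom.mk' (affineIsometry o) fun g h => by
    refine AffineIsometryEquiv.ext fun v => ?_
    rw [AffineIsometryEquiv.coe_mul, Function.comp_apply]
    refine UniformSpace.Completion.induction_on v ?_ fun v => ?_
    · exact isClosed_eq (affineIsometry o (g * h)).continuous
        ((affineIsometry o g).continuous.comp (affineIsometry o h).continuous)
    · rw [affineIsometry_coe, affineIsometry_coe, affineIsometry_coe, affineMap_mul]

theorem affineAction_coe (g : G) (v : FreeNormedSpace X o) :
    affineAction G o g (v : FreeBanachSpace X o) = (affineMap g v : FreeNormedSpace X o) :=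
  affineIsometry_coe g v

/-- Orbit maps are continuous on a dense set, hence everywhere; since each map is an isometry, this
already gives joint continuity. -/
theorem isContinuousAction_affineAction [TopologicalSpace G]
    (hX : ∀ x : X, Continuous fun g : G => g • x) : IsContinuousAction (affineAction G o) := by
  let _ : SMul G (FreeBanachSpace X o) := ⟨fun g v => affineAction G o g v⟩
  have : IsIsometricSMul G (FreeBanachSpace X o) := ⟨fun g => (affineAction G o g).isometry⟩
  have hc : ∀ v : FreeBanachSpace X o, Continuous fun g : G => affineAction G o g v :=
    continuous_smul_left_of_dense (i := ((↑) : FreeNormedSpace X o → FreeBanachSpace X o))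
      UniformSpace.Completion.denseRange_coe fun v => by
        change Continuous fun g => affineAction G o g (v : FreeBanachSpace X o)
        simp only [affineAction_coe]
        exact (UniformSpace.Completion.continuous_coe _).comp (continuous_affineMap hX v)
  refine continuous_iff_continuousAt.2 fun ⟨g, v⟩ => ?_
  refine tendsto_iff_dist_tendsto_zero.2 (squeeze_zero (fun _ => dist_nonneg)
    (fun q => dist_triangle _ (affineAction G o q.1 v) _) ?_)
  simp only [AffineIsometryEquiv.dist_map]
  have h1 : Continuous fun q : G × FreeBanachSpace X o =>
      dist q.2 v + dist (affineAction G o q.1 v) (affineAction G o g v) :=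
    (continuous_snd.dist continuous_const).add
      (((hc v).comp continuous_fst).dist continuous_const)
  simpa using h1.tendsto (g, v)

theorem isStronglyMoving_affineAction {ε : ℝ} (h : MovesFiniteSets G X ε) (hε : 0 < ε) :
    IsStronglyMoving (affineAction G o) := by
  let _ : SMul G (FreeBanachSpace X o) := ⟨fun g v => affineAction G o g v⟩
  let _ : SMul G (FreeNormedSpace X o) := ⟨affineMap⟩
  have : IsIsometricSMul G (FreeBanachSpace X o) := ⟨fun g => (affineAction G o g).isometry⟩
  have hm : MovesFiniteSets G (FreeNormedSpace X o) ε := fun s hs =>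
    exists_le_dist_affineMap h hε hs
  exact ⟨ε / 2, half_pos hε, hm.of_dense (i := ((↑) : FreeNormedSpace X o → FreeBanachSpace X o))
    UniformSpace.Completion.coe_isometry UniformSpace.Completion.denseRange_coe
    (fun g v => (affineAction_coe g v).symm) hε⟩

end FreeBanachSpace

/-! ### Fixed points of precompact groups -/

section FixedPoint

variable {G : Type u} [Group G] {E : Type v} [NormedAddCommGroup E] [NormedSpace ℝ E]

theorem totallyBounded_orbit [TopologicalSpace G] [IsTopologicalGroup G]
    (hG : IsPrecompactGroup G) {ρ : G →* (E ≃ᵃⁱ[ℝ] E)} (hρ : IsContinuousAction ρ) (x : E) :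
    TotallyBounded (Set.range fun g => ρ g x) := by
  refine Metric.totallyBounded_iff.2 fun ε hε => ?_
  have hc : Continuous fun g => ρ g x := hρ.comp (continuous_id.prodMk continuous_const)
  obtain ⟨F, hF, hFV⟩ := hG ((fun g => ρ g x) ⁻¹' Metric.ball x ε) (Metric.isOpen_ball.preimage hc)
    ⟨1, by simpa using hε⟩
  refine ⟨(fun g => ρ g x) '' F, hF.image _, ?_⟩
  rintro _ ⟨g, rfl⟩
  obtain ⟨f, hf, v, hv, rfl⟩ : g ∈ F * _ := hFV ▸ Set.mem_univ g
  refine Set.mem_biUnion ⟨f, hf, rfl⟩ ?_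
  change dist (ρ (f * v) x) (ρ f x) < ε
  rw [map_mul, AffineIsometryEquiv.coe_mul, Function.comp_apply, AffineIsometryEquiv.dist_map]
  exact hv

/-- Compact convex sets have normal structure: if they have more than one point, they contain a
point from which the set looks smaller than it is. -/
theorem exists_forall_dist_le_of_isCompact_of_convex {C : Set E} (hC : IsCompact C)
    (hconv : Convex ℝ C) (hd : 0 < Metric.diam C) :
    ∃ u ∈ C, ∃ r < Metric.diam C, ∀ y ∈ C, dist u y ≤ r := by
  classical
  set d := Metric.diam C
  have hdist : ∀ x ∈ C, ∀ y ∈ C, dist x y ≤ d := fun x hx y hy =>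
    Metric.dist_le_diam_of_mem hC.isBounded hx hy
  obtain ⟨t, htC, htf, ht⟩ := Metric.finite_approx_of_totallyBounded hC.totallyBounded (d / 2)
    (half_pos hd)
  obtain ⟨t, rfl⟩ := htf.exists_finset_coe
  have hCne : C.Nonempty := by
    rw [Set.nonempty_iff_ne_empty]
    rintro rfl
    simp [d] at hd
  have htne : t.Nonempty := by
    obtain ⟨y, hy⟩ := hCne
    obtain ⟨x, hx, -⟩ := Set.mem_iUnion₂.1 (ht hy)
    exact ⟨x, hx⟩
  have hpos : (0 : ℝ) < t.card := by exact_mod_cast htne.card_pos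
  have hsum : ∑ _x ∈ t, (t.card : ℝ)⁻¹ = 1 := by
    rw [Finset.sum_const, nsmul_eq_mul, mul_inv_cancel₀ hpos.ne']
  have hw : ∀ x ∈ t, (0 : ℝ) ≤ (t.card : ℝ)⁻¹ := fun _ _ => (inv_pos.2 hpos).le
  -- The point is the barycentre of a finite `d / 2`-net. Each `y` is within `d / 2` of one net
  -- point, which lowers the average distance by `d / 2` times the weight of that point.
  refine ⟨∑ x ∈ t, (t.card : ℝ)⁻¹ • x, hconv.sum_mem hw hsum fun x hx => htC hx,
    d - (t.card : ℝ)⁻¹ * (d / 2), ?_, fun y hy => ?_⟩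
  · have := mul_pos (inv_pos.2 hpos) (half_pos hd)
    linarith
  obtain ⟨x₀, hx₀, hyx₀⟩ := Set.mem_iUnion₂.1 (ht hy)
  have hy' : y = ∑ _x ∈ t, (t.card : ℝ)⁻¹ • y := by rw [← Finset.sum_smul, hsum, one_smul]
  calc dist (∑ x ∈ t, (t.card : ℝ)⁻¹ • x) y
      ≤ ∑ x ∈ t, (t.card : ℝ)⁻¹ * dist x y := by
        conv_lhs => rw [hy']
        refine (dist_sum_sum_le _ _ _).trans_eq (Finset.sum_congr rfl fun x _ => ?_)
        rw [dist_smul₀, Real.norm_of_nonneg (inv_pos.2 hpos).le]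
    _ ≤ ∑ x ∈ t, ((t.card : ℝ)⁻¹ * d - if x = x₀ then (t.card : ℝ)⁻¹ * (d / 2) else 0) := by
        refine Finset.sum_le_sum fun x hx => ?_
        split_ifs with h
        · rw [← mul_sub, h, dist_comm]
          refine mul_le_mul_of_nonneg_left ?_ (hw x hx)
          have : dist y x₀ < d / 2 := hyx₀
          linarith
        · rw [sub_zero]
          exact mul_le_mul_of_nonneg_left (hdist x (htC hx) y hy) (hw x hx)
    _ = d - (t.card : ℝ)⁻¹ * (d / 2) := by
        rw [Finset.sum_sub_distrib, ← Finset.sum_mul, hsum, one_mul, Finset.sum_ite_eq',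
          if_pos (by simpa using hx₀)]

/-- Zorn's lemma gives a minimal invariant compact convex set `C`. If its diameter were positive,
the points of `C` within `r` of all of `C`, for some `r` less than the diameter, would form a
non-empty invariant compact convex subset. By minimality it is `C`, whose diameter is then at most
`r`. -/
theorem exists_fixed_point_of_isCompact_of_convex {ρ : G →* (E ≃ᵃⁱ[ℝ] E)} {K : Set E}
    (hK : IsCompact K) (hconv : Convex ℝ K) (hne : K.Nonempty)
    (hinv : ∀ g, ∀ x ∈ K, ρ g x ∈ K) : HasFixedPoint ρ := by
  let S : Set (Set E) := {C | IsCompact C ∧ Convex ℝ C ∧ C.Nonempty ∧ ∀ g, ∀ x ∈ C, ρ g x ∈ C}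
  obtain ⟨C, -, hCmin⟩ := zorn_superset_nonempty S (by
    intro c hc hchain hcne
    refine ⟨⋂₀ c, ⟨?_, convex_sInter fun C hC => (hc hC).2.1, ?_, fun g x hx C hC =>
      (hc hC).2.2.2 g x (hx C hC)⟩, fun C hC => Set.sInter_subset_of_mem hC⟩
    · obtain ⟨C, hC⟩ := hcne
      exact (hc hC).1.of_isClosed_subset (isClosed_sInter fun C hC => (hc hC).1.isClosed)
        (Set.sInter_subset_of_mem hC)
    · have := hcne.to_subtype
      exact IsCompact.nonempty_sInter_of_directed_nonempty_isCompact_isClosed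
        (fun A hA B hB => (hchain.total hA hB).elim (fun h => ⟨A, hA, subset_rfl, h⟩)
          fun h => ⟨B, hB, h, subset_rfl⟩) (fun C hC => (hc hC).2.2.1) (fun C hC => (hc hC).1)
        (fun C hC => (hc hC).1.isClosed)) K ⟨hK, hconv, hne, hinv⟩
  obtain ⟨⟨hCc, hCconv, ⟨ξ, hξ⟩, hCinv⟩, hmin⟩ := hCmin
  rcases (Metric.diam_nonneg (s := C)).eq_or_lt with hd | hd
  · refine ⟨ξ, fun g => dist_le_zero.1 ?_⟩
    rw [hd]
    exact Metric.dist_le_diam_of_mem hCc.isBounded (hCinv g ξ hξ) hξ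
  obtain ⟨u, hu, r, hr, hur⟩ := exists_forall_dist_le_of_isCompact_of_convex hCc hCconv hd
  have hD : C ∩ ⋂ y ∈ C, Metric.closedBall y r ∈ S := by
    refine ⟨hCc.inter_right (isClosed_biInter fun y _ => Metric.isClosed_closedBall),
      hCconv.inter (convex_iInter₂ fun y _ => convex_closedBall y r),
      ⟨u, hu, Set.mem_iInter₂.2 hur⟩, fun g x hx => ⟨hCinv g x hx.1, Set.mem_iInter₂.2 ?_⟩⟩
    intro y hy
    have h1 := Set.mem_iInter₂.1 hx.2 _ (hCinv g⁻¹ y hy)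
    rw [Metric.mem_closedBall, ← (ρ g).dist_map, ← Function.comp_apply (f := ρ g),
      ← AffineIsometryEquiv.coe_mul, ← map_mul, mul_inv_cancel, map_one] at h1
    exact h1
  have hsub := hmin hD Set.inter_subset_left
  refine (hr.not_ge (Metric.diam_le_of_forall_dist_le (dist_nonneg.trans (hur u hu)) ?_)).elim
  intro x hx y hy
  exact Set.mem_iInter₂.1 (hsub hx).2 y hy

theorem IsPrecompactGroup.hasFixedPoint [TopologicalSpace G] [IsTopologicalGroup G]
    [CompleteSpace E] (hG : IsPrecompactGroup G) {ρ : G →* (E ≃ᵃⁱ[ℝ] E)}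
    (hρ : IsContinuousAction ρ) : HasFixedPoint ρ := by
  set O := Set.range fun g => ρ g 0
  refine exists_fixed_point_of_isCompact_of_convex (K := closure (convexHull ℝ O))
    ((totallyBounded_orbit hG hρ 0).convexHull.closure.isCompact_of_isClosed isClosed_closure)
    (convex_convexHull ℝ O).closure
    (((Set.range_nonempty _).mono (subset_convexHull ℝ O)).mono subset_closure) fun g x hx => ?_
  have hO : ρ g '' O ⊆ O := by
    rintro _ ⟨_, ⟨h, rfl⟩, rfl⟩
    exact ⟨g * h, by simp [AffineIsometryEquiv.coe_mul]⟩
  have hH : ρ g '' convexHull ℝ O ⊆ convexHull ℝ O := by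
    have := (ρ g).toAffineEquiv.toAffineMap.image_convexHull O
    exact this.subset.trans (convexHull_mono hO)
  exact closure_mono hH (image_closure_subset_closure_image (ρ g).continuous ⟨x, hx, rfl⟩)

theorem IsStronglyMoving.not_hasFixedPoint {ρ : G →* (E ≃ᵃⁱ[ℝ] E)} (h : IsStronglyMoving ρ) :
    ¬ HasFixedPoint ρ := by
  rintro ⟨ξ, hξ⟩
  obtain ⟨ε, hε, h⟩ := h
  obtain ⟨g, hg⟩ := h {ξ} (Set.finite_singleton ξ)
  have := hg ξ rfl ξ rfl
  rw [hξ, dist_self] at this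
  linarith

end FixedPoint

/-! ### The equivalence of the three conditions -/

theorem mainTheorem2 (G : Type u) [Group G] [TopologicalSpace G] [IsTopologicalGroup G]
    (hG : TopologicalSpace.SeparableSpace G ∨ IsOmegaBoundedGroup G) :
    (∃ (U : Type) (_ : MetricSpace U), IsUrysohnSpace U) ∧
    ∀ (U : Type v) [MetricSpace U], IsUrysohnSpace U → ∀ o : U,
      List.TFAE [
        ¬ IsPrecompactGroup G,
        ∃ ρ : G →* (FreeBanachSpace U o ≃ᵃⁱ[ℝ] FreeBanachSpace U o),
          IsContinuousAction ρ ∧ ¬ HasFixedPoint ρ,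
        ∃ ρ : G →* (FreeBanachSpace U o ≃ᵃⁱ[ℝ] FreeBanachSpace U o),
          IsContinuousAction ρ ∧ IsStronglyMoving ρ] ∧
      (IsPrecompactGroup G ↔
        ∀ ρ : G →* (FreeBanachSpace U o ≃ᵃⁱ[ℝ] FreeBanachSpace U o),
          IsContinuousAction ρ → HasFixedPoint ρ) := by
  have hb : IsOmegaBoundedGroup G := hG.elim (fun _ => isOmegaBoundedGroup_of_separableSpace) id
  refine ⟨?_, fun U _ hU o => ?_⟩
  · obtain ⟨Y, _, _, _, _, hY⟩ := exists_hasOnePointExtensions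
    exact ⟨Y, inferInstance, hY.isUrysohnSpace⟩
  have h13 : ¬ IsPrecompactGroup G →
      ∃ ρ : G →* (FreeBanachSpace U o ≃ᵃⁱ[ℝ] FreeBanachSpace U o),
        IsContinuousAction ρ ∧ IsStronglyMoving ρ := fun hG => by
    obtain ⟨X, _, _, _, _, _, hX, ε, hε, hm⟩ := hb.exists_movesFiniteSets hG
    obtain ⟨_, _, hc, hmU⟩ := hU.exists_movesFiniteSets X hX hε hm
    exact ⟨FreeBanachSpace.affineAction G o, FreeBanachSpace.isContinuousAction_affineAction hc,
      FreeBanachSpace.isStronglyMoving_affineAction hmU (half_pos hε)⟩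
  constructor
  · tfae_have 1 → 3 := h13
    tfae_have 3 → 2 := fun ⟨ρ, hρ, hm⟩ => ⟨ρ, hρ, hm.not_hasFixedPoint⟩
    tfae_have 2 → 1 := fun ⟨ρ, hρ, hf⟩ hG => hf (hG.hasFixedPoint hρ)
    tfae_finish
  · refine ⟨fun hG ρ hρ => hG.hasFixedPoint hρ, fun h => by_contra fun hG => ?_⟩
    obtain ⟨ρ, hρ, hm⟩ := h13 hG
    exact hm.not_hasFixedPoint (h ρ hρ)
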